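/- **Setting.** A 2-point graph is a finite graph with edges coloured $0,1,2,3$, in which every internal node is incident to exactly one edge of each colour, together with two distinguished univalent external vertices (a root leg and a second leg), each incident to a single edge, of colour $0$. Edges of colour $0$ are called propagators, and the connected components of the subgraph of colours $1,2,3$ are called bubbles. The simplest 2-point graph is the bare propagator, which joins the two legs. An elementary melon of type I consists of two tetrahedral bubbles (properly edge-coloured $K_4$'s), one node of each attached to an external leg and the other three pairs of corresponding nodes joined by propagators. An elementary melon of type II consists of a pillow bubble of colour $\ell\in\{1,2,3\}$ (four nodes, two pairs of nodes each joined by two edges of the colours $\neq \ell$, the pairs being joined by two edges of colour $\ell$), where the two nodes of one pair are attached to the external legs and those of the other pair are joined by a propagator. A 2-point graph is melonic if it is obtained from the bare propagator by successively inserting elementary melons of type I and II on propagators. Let $C_{p,q}$ be the number of melonic 2-point graphs with $p$ type I and $q$ type II melons, up to isomorphism (fixing the legs and preserving the colours) and up to local permutations of the colours $1,2,3$ at each pillow bubble, and let $$G_{LO}(g,\mu)=\sum_{p,q\in\mathbb N} C_{p,q}\,g^{p+q}\mu^q=\sum_{n\in\mathbb N}\alpha_n(\mu)\,g^n ,\qquad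 \alpha_n(\mu)=\sum_{q=0}^{n} C_{n-q,q}\,\mu^q .$$ For $\mu\ge 0$ let $G_c(\mu)$ be the unique nonzero real solution of $-3x^3+4x^2-\mu x+2\mu=0$ (for $\mu>0$ it is the unique real solution), and put $$g_c(\mu)=\frac{G_c(\mu)-1}{G_c(\mu)^2\,(G_c(\mu)^2+\mu)},\qquad K(\mu)=\sqrt{\frac{G_c(\mu)^2\,(G_c(\mu)^2+\mu)}{6\,G_c(\mu)^2+\mu}} .$$ **Corollary.** For every $\mu\ge 0$, the coefficients of the power series $G_{LO}(\cdot,\mu)$ satisfy $$\alpha_n(\mu)\underset{n\to+\infty}{\sim}\frac{K(\mu)\,g_c(\mu)^{-n}}{2\sqrt{\pi}\,n^{3/2}} .$$ In particular, the number $\mathcal M_n$ of melonic 2-point graphs with $n$ elementary melons (up to isomorphism fixing the legs and preserving the colours) satisfies $$\mathcal M_n\underset{n\to+\infty}{\sim}\frac{\chi\,\beta^n}{n^{3/2}},\qquad \chi=\frac{K(3)}{2\sqrt\pi}\approx 0.242,\qquad \beta=\frac1{g_c(3)}\approx 23.6,$$ where the numerical values mean $|\chi-0.242|<0.0005$ and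 $|\beta-23.6|<0.05$. -/

import Mathlib

open Filter Asymptotics

/-- A Feynman graph of the `O(N)^{⊗3}` tensor model with two external legs, i.e. a `4`-coloured
graph with two univalent external vertices.  The set of nodes is `V`; each node carries exactly one
half-edge of each of the colours `1, 2, 3` (indexed by `Fin 3`) and one propagator half-line
(colour `0`).  `bond c v` is the node joined to `v` by the edge of colour `c`; the connected
components of the bonds are the bubbles (interaction vertices).  The propagators form a perfect
matching `line` of `V ⊕ Bool`, where `Sum.inr false` is the root external leg and `Sum.inr true`
is the other external leg. -/
structure TwoPointGraph where
  V : Type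
  finite : Finite V
  bond : Fin 3 → V → V
  bond_bond : ∀ c v, bond c (bond c v) = v
  bond_ne : ∀ c v, bond c v ≠ v
  line : V ⊕ Bool → V ⊕ Bool
  line_line : ∀ x, line (line x) = x
  line_ne : ∀ x, line x ≠ x

namespace TwoPointGraph

/-- The ends of propagators: nodes and external legs. -/
abbrev End (G : TwoPointGraph) : Type := G.V ⊕ Bool

/-- The bare propagator: no bubble, the two external legs are joined to each other. -/
def bare : TwoPointGraph where
  V := Empty
  finite := inferInstance
  bond := fun _ v => v
  bond_bond := fun _ v => v.elim
  bond_ne := fun _ v => v.elim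
  line := Sum.map id not
  line_line := by rintro (x | _ | _) <;> [exact x.elim; rfl; rfl]
  line_ne := by rintro (x | _ | _) <;> [exact x.elim; simp; simp]

/-- The edges of colour `c` of a tetrahedral bubble with nodes `Bool × Bool`. -/
def tetraBond (c : Fin 3) (v : Bool × Bool) : Bool × Bool :=
  if c = 0 then (!v.1, v.2) else if c = 1 then (v.1, !v.2) else (!v.1, !v.2)

/-- The edges of colour `c` of the pillow bubble of colour `l` with nodes `Bool × Bool`: nodes with
the same first coordinate are joined by the two edges of colours different from `l`, nodes with the
same second coordinate by an edge of colour `l`. -/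
def pillowBond (l c : Fin 3) (v : Bool × Bool) : Bool × Bool :=
  if c = l then (!v.1, v.2) else (v.1, !v.2)

/-- The elementary melon of type I: two tetrahedra (distinguished by the first coordinate), one node
of each carrying an external leg, the three other pairs of corresponding nodes being joined by
propagators. -/
def melonI : TwoPointGraph where
  V := Bool × (Bool × Bool)
  finite := inferInstance
  bond := fun c v => (v.1, tetraBond c v.2)
  bond_bond := by decide
  bond_ne := by decide
  line := Sum.elim
    (fun v => if v.2 = (false, false) then Sum.inr v.1 else Sum.inl (!v.1, v.2))
    (fun s => Sum.inl (s, (false, false)))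
  line_line := by decide
  line_ne := by decide

/-- The elementary melon of type II and colour `l`: one pillow; two nodes joined by two edges carry
the external legs, the two other ones are joined by a propagator. -/
def melonII (l : Fin 3) : TwoPointGraph where
  V := Bool × Bool
  finite := inferInstance
  bond := pillowBond l
  bond_bond := by revert l; decide
  bond_ne := by revert l; decide
  line := Sum.elim
    (fun v => if v.1 then Sum.inl (true, !v.2) else Sum.inr v.2)
    (fun s => Sum.inl (false, s))
  line_line := by decide
  line_ne := by decide

/-- Propagator ends of `H` viewed in the graph obtained by inserting `H` on the line `{a, line a}`
of `G`: the root leg of `H` becomes `a`, the other leg becomes `line a`. -/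
def insertRight (G H : TwoPointGraph) (a : G.End) : H.End → (G.V ⊕ H.V) ⊕ Bool
  | Sum.inl h => Sum.inl (Sum.inr h)
  | Sum.inr false => Sum.map Sum.inl id a
  | Sum.inr true => Sum.map Sum.inl id (G.line a)

theorem insertRight_injective (G H : TwoPointGraph) (a : G.End) :
    Function.Injective (insertRight G H a) := by
  have hinj : Function.Injective (Sum.map (Sum.inl : G.V → G.V ⊕ H.V) (id : Bool → Bool)) :=
    Sum.map_injective.2 ⟨Sum.inl_injective, Function.injective_id⟩
  have hne : ∀ (b : G.End) (h : H.V),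
      (Sum.inl (Sum.inr h) : (G.V ⊕ H.V) ⊕ Bool) ≠ Sum.map Sum.inl id b := by
    rintro (b | b) h <;> simp
  have ha : Sum.map (Sum.inl : G.V → G.V ⊕ H.V) (id : Bool → Bool) (G.line a) ≠
      Sum.map Sum.inl id a := fun h => G.line_ne a (hinj h)
  rintro (x | _ | _) (y | _ | _) h <;> simp only [insertRight] at h
  · simpa using h
  · exact absurd h (hne _ _)
  · exact absurd h (hne _ _)
  · exact absurd h.symm (hne _ _)
  · rfl
  · exact absurd h.symm ha
  · exact absurd h.symm (hne _ _)
  · exact absurd h ha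
  · rfl

open Classical in
/-- The propagators after inserting `H` on the line `{a, line a}` of `G`. -/
noncomputable def insertLine (G H : TwoPointGraph) (a : G.End) :
    (G.V ⊕ H.V) ⊕ Bool → (G.V ⊕ H.V) ⊕ Bool
  | Sum.inl (Sum.inr h) => insertRight G H a (H.line (Sum.inl h))
  | Sum.inl (Sum.inl v) =>
      if Sum.inl v = a then insertRight G H a (H.line (Sum.inr false))
      else if Sum.inl v = G.line a then insertRight G H a (H.line (Sum.inr true))
      else Sum.map Sum.inl id (G.line (Sum.inl v))
  | Sum.inr s =>
      if Sum.inr s = a then insertRight G H a (H.line (Sum.inr false))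
      else if Sum.inr s = G.line a then insertRight G H a (H.line (Sum.inr true))
      else Sum.map Sum.inl id (G.line (Sum.inr s))

open Classical in
theorem insertLine_left (G H : TwoPointGraph) (a x : G.End) :
    insertLine G H a (Sum.map Sum.inl id x) =
      if x = a then insertRight G H a (H.line (Sum.inr false))
      else if x = G.line a then insertRight G H a (H.line (Sum.inr true))
      else Sum.map Sum.inl id (G.line x) := by
  rcases x with x | x <;> rfl

theorem insertLine_right (G H : TwoPointGraph) (a : G.End) (y : H.End) :
    insertLine G H a (insertRight G H a y) = insertRight G H a (H.line y) := by
  rcases y with y | _ | _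
  · rfl
  · simp [insertRight, insertLine_left]
  · simp [insertRight, insertLine_left, G.line_ne a]

theorem insertLine_cases (G H : TwoPointGraph) (a : G.End) (z : (G.V ⊕ H.V) ⊕ Bool) :
    (∃ y : H.End, z = insertRight G H a y) ∨
      ∃ x : G.End, x ≠ a ∧ x ≠ G.line a ∧ z = Sum.map Sum.inl id x := by
  have key : ∀ x : G.End, z = Sum.map Sum.inl id x →
      (∃ y : H.End, z = insertRight G H a y) ∨
      ∃ x : G.End, x ≠ a ∧ x ≠ G.line a ∧ z = Sum.map Sum.inl id x := by
    intro x hx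
    by_cases h1 : x = a
    · exact Or.inl ⟨Sum.inr false, by rw [hx, h1]; rfl⟩
    by_cases h2 : x = G.line a
    · exact Or.inl ⟨Sum.inr true, by rw [hx, h2]; rfl⟩
    exact Or.inr ⟨x, h1, h2, hx⟩
  rcases z with (v | h) | s
  · exact key (Sum.inl v) rfl
  · exact Or.inl ⟨Sum.inl h, rfl⟩
  · exact key (Sum.inr s) rfl

/-- Insertion of the two-point graph `H` on the propagator `{a, line a}` of `G`, with the root leg
of `H` on the side of `a`. -/
noncomputable def insert (G : TwoPointGraph) (a : G.End) (H : TwoPointGraph) : TwoPointGraph where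
  V := G.V ⊕ H.V
  finite := by
    have := G.finite
    have := H.finite
    infer_instance
  bond := fun c => Sum.map (G.bond c) (H.bond c)
  bond_bond := by rintro c (v | v) <;> simp [G.bond_bond, H.bond_bond]
  bond_ne := by rintro c (v | v) <;> simp [G.bond_ne, H.bond_ne]
  line := insertLine G H a
  line_line := by
    intro z
    rcases insertLine_cases G H a z with ⟨y, rfl⟩ | ⟨x, h1, h2, rfl⟩
    · rw [insertLine_right, insertLine_right, H.line_line]
    · have h3 : G.line x ≠ a := fun h => h2 (by rw [← h, G.line_line])
      have h4 : G.line x ≠ G.line a := fun h => h1 (by rw [← G.line_line x, h, G.line_line])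
      rw [insertLine_left, if_neg h1, if_neg h2, insertLine_left, if_neg h3, if_neg h4, G.line_line]
  line_ne := by
    intro z
    rcases insertLine_cases G H a z with ⟨y, rfl⟩ | ⟨x, h1, h2, rfl⟩
    · rw [insertLine_right]
      exact fun h => H.line_ne y (insertRight_injective G H a h)
    · rw [insertLine_left, if_neg h1, if_neg h2]
      exact fun h => G.line_ne x
        (Sum.map_injective.2 ⟨Sum.inl_injective, Function.injective_id⟩ h)

/-- `IsMelonic p q G`: the two-point graph `G` is obtained from the bare propagator by successive
insertions, on arbitrary propagators, of `p` elementary melons of type I and `q` elementary melons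
of type II (of arbitrary colours). -/
inductive IsMelonic : ℕ → ℕ → TwoPointGraph → Prop
  | bare : IsMelonic 0 0 bare
  | insertI {p q : ℕ} {G : TwoPointGraph} (hG : IsMelonic p q G) (a : G.End) :
      IsMelonic (p + 1) q (G.insert a melonI)
  | insertII {p q : ℕ} {G : TwoPointGraph} (hG : IsMelonic p q G) (a : G.End) (l : Fin 3) :
      IsMelonic p (q + 1) (G.insert a (melonII l))

/-- The node `v` belongs to a pillow bubble. -/
def IsPillowNode (G : TwoPointGraph) (v : G.V) : Prop :=
  ∃ l : Fin 3,
    (∀ c d, c ≠ l → d ≠ l → G.bond c v = G.bond d v ∧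
      G.bond c (G.bond l v) = G.bond d (G.bond l v)) ∧
    ∀ c, c ≠ l → G.bond c v ≠ G.bond l v ∧ G.bond c (G.bond l v) = G.bond l (G.bond c v)

/-- `e` is a bijection of the nodes which, extended by the identity on the two external legs,
preserves the propagators, and which maps edges of colour `c` at `v` to edges of colour `π v c`,
where the permutation `π v` of the colours depends only on the bubble of `v`. -/
structure IsRecoloring (G H : TwoPointGraph) (e : G.V ≃ H.V) (π : G.V → Equiv.Perm (Fin 3)) :
    Prop where
  line : ∀ x, H.line (Sum.map e id x) = Sum.map e id (G.line x)
  bond : ∀ c v, H.bond (π v c) (e v) = e (G.bond c v)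
  const : ∀ c v, π (G.bond c v) = π v

theorem IsRecoloring.refl (G : TwoPointGraph) : IsRecoloring G G (Equiv.refl _) (fun _ => 1) :=
  ⟨fun x => by rcases x with x | x <;> simp, fun c v => by simp, fun _ _ => rfl⟩

theorem IsRecoloring.symm {G H : TwoPointGraph} {e : G.V ≃ H.V} {π : G.V → Equiv.Perm (Fin 3)}
    (h : IsRecoloring G H e π) : IsRecoloring H G e.symm (fun u => (π (e.symm u))⁻¹) := by
  have hb : ∀ c u, G.bond ((π (e.symm u))⁻¹ c) (e.symm u) = e.symm (H.bond c u) := by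
    intro c u
    have := h.bond ((π (e.symm u))⁻¹ c) (e.symm u)
    rw [show π (e.symm u) ((π (e.symm u))⁻¹ c) = c from (π (e.symm u)).apply_symm_apply c,
      Equiv.apply_symm_apply] at this
    rw [this, Equiv.symm_apply_apply]
  refine ⟨fun x => ?_, hb, fun c u => ?_⟩
  · have hx : Sum.map e (id : Bool → Bool) (Sum.map e.symm id x) = x := by
      rcases x with x | x <;> simp
    have := h.line (Sum.map e.symm id x)
    rw [hx] at this
    rw [this]
    rcases G.line (Sum.map e.symm id x) with y | y <;> simp
  · rw [← hb, h.const]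

theorem IsRecoloring.trans {G H K : TwoPointGraph} {e : G.V ≃ H.V} {f : H.V ≃ K.V}
    {π : G.V → Equiv.Perm (Fin 3)} {ρ : H.V → Equiv.Perm (Fin 3)}
    (h : IsRecoloring G H e π) (k : IsRecoloring H K f ρ) :
    IsRecoloring G K (e.trans f) (fun v => ρ (e v) * π v) := by
  refine ⟨fun x => ?_, fun c v => ?_, fun c v => ?_⟩
  · have hx : ∀ x : G.End, Sum.map (e.trans f) (id : Bool → Bool) x =
        Sum.map f id (Sum.map e id x) := by
      rintro (x | x) <;> simp
    rw [hx, hx, k.line, h.line]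
  · simp only [Equiv.trans_apply, Equiv.Perm.mul_apply]
    rw [k.bond, h.bond]
  · show ρ (e (G.bond c v)) * π (G.bond c v) = ρ (e v) * π v
    rw [h.const, ← h.bond, k.const]

theorem IsRecoloring.isPillowNode {G H : TwoPointGraph} {e : G.V ≃ H.V}
    {π : G.V → Equiv.Perm (Fin 3)} (h : IsRecoloring G H e π) {v : G.V}
    (hv : G.IsPillowNode v) : H.IsPillowNode (e v) := by
  obtain ⟨l, h1, h2⟩ := hv
  have hb : ∀ c, H.bond (π v c) (e v) = e (G.bond c v) := fun c => h.bond c v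
  have hbb : ∀ c d, H.bond (π v c) (e (G.bond d v)) = e (G.bond c (G.bond d v)) := by
    intro c d
    rw [← h.bond c (G.bond d v), h.const]
  refine ⟨π v l, fun c d hc hd => ?_, fun c hc => ?_⟩
  · obtain ⟨c, rfl⟩ := (π v).surjective c
    obtain ⟨d, rfl⟩ := (π v).surjective d
    have hc' : c ≠ l := fun h => hc (by rw [h])
    have hd' : d ≠ l := fun h => hd (by rw [h])
    simp only [hb, hbb]
    exact ⟨by rw [(h1 c d hc' hd').1], by rw [(h1 c d hc' hd').2]⟩
  · obtain ⟨c, rfl⟩ := (π v).surjective c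
    have hc' : c ≠ l := fun h => hc (by rw [h])
    simp only [hb, hbb]
    exact ⟨fun h => (h2 c hc').1 (e.injective h), by rw [(h2 c hc').2]⟩

/-- Isomorphism of two-point graphs: it preserves all colours and fixes the two external legs. -/
def Isomorphic (G H : TwoPointGraph) : Prop :=
  ∃ e : G.V ≃ H.V, IsRecoloring G H e (fun _ => 1)

/-- Equality up to isomorphism and local colour permutations at the pillow bubbles: on each pillow
the colours may be permuted, on every other bubble they are preserved. -/
def LocallyIsomorphic (G H : TwoPointGraph) : Prop :=
  ∃ (e : G.V ≃ H.V) (π : G.V → Equiv.Perm (Fin 3)),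
    IsRecoloring G H e π ∧ ∀ v, ¬ G.IsPillowNode v → π v = 1

/-- Isomorphism as a setoid. -/
def isoSetoid : Setoid TwoPointGraph where
  r := Isomorphic
  iseqv :=
    { refl := fun G => ⟨_, IsRecoloring.refl G⟩
      symm := by
        rintro G H ⟨e, h⟩
        exact ⟨e.symm, by simpa using h.symm⟩
      trans := by
        rintro G H K ⟨e, h⟩ ⟨f, k⟩
        exact ⟨e.trans f, by simpa using h.trans k⟩ }

/-- Isomorphism up to local colour permutations at the pillow bubbles, as a setoid. -/
def localSetoid : Setoid TwoPointGraph where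
  r := LocallyIsomorphic
  iseqv :=
    { refl := fun G => ⟨_, _, IsRecoloring.refl G, fun _ _ => rfl⟩
      symm := by
        rintro G H ⟨e, π, h, hπ⟩
        refine ⟨e.symm, _, h.symm, fun u hu => ?_⟩
        have : π (e.symm u) = 1 := hπ _ fun hp => hu (by simpa using h.isPillowNode hp)
        simp [this]
      trans := by
        rintro G H K ⟨e, π, h, hπ⟩ ⟨f, ρ, k, hρ⟩
        refine ⟨e.trans f, _, h.trans k, fun v hv => ?_⟩
        have h1 : π v = 1 := hπ v hv
        have h2 : ρ (e v) = 1 := hρ _ fun hp => hv (by simpa using h.symm.isPillowNode hp)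
        simp [h1, h2] }

end TwoPointGraph

open TwoPointGraph in
/-- The number of melonic two-point graphs with `p` type I melons and `q` type II melons, up to
isomorphism and local colour permutations of the type II vertices. -/
noncomputable def melonicClassCount (p q : ℕ) : ℕ :=
  {x : Quotient localSetoid | ∃ G, IsMelonic p q G ∧ Quotient.mk localSetoid G = x}.ncard

open TwoPointGraph in
/-- The number of melonic two-point graphs with `n` elementary melons, up to isomorphism. -/
noncomputable def melonicGraphCount (n : ℕ) : ℕ :=
  {x : Quotient isoSetoid |
    ∃ p q G, p + q = n ∧ IsMelonic p q G ∧ Quotient.mk isoSetoid G = x}.ncard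

/-- The leading-order two-point function `∑_{p,q} C_{p,q} g^{p+q} μ^q` as a power series in `g`. -/
noncomputable def leadingOrderSeries (μ : ℝ) : PowerSeries ℝ :=
  PowerSeries.mk fun n =>
    ∑ q ∈ Finset.range (n + 1), (melonicClassCount (n - q) q : ℝ) * μ ^ q

theorem existsUnique_critical_root (μ : ℝ) (hμ : 0 ≤ μ) :
    ∃! x : ℝ, x ≠ 0 ∧ -3 * x ^ 3 + 4 * x ^ 2 - μ * x + 2 * μ = 0 := by
  have hcont : ContinuousOn (fun x : ℝ => -3 * x ^ 3 + 4 * x ^ 2 - μ * x + 2 * μ)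
      (Set.Icc (4 / 3) 2) := by fun_prop
  have hmem : (0 : ℝ) ∈ (fun x : ℝ => -3 * x ^ 3 + 4 * x ^ 2 - μ * x + 2 * μ) ''
      Set.Icc (4 / 3) 2 :=
    intermediate_value_Icc' (by norm_num) hcont ⟨by norm_num; linarith, by norm_num; linarith⟩
  obtain ⟨x, ⟨hx1, hx2⟩, hx⟩ := hmem
  have hx' : -3 * x ^ 3 + 4 * x ^ 2 - μ * x + 2 * μ = 0 := hx
  have key : ∀ y : ℝ, y ≠ 0 → -3 * y ^ 3 + 4 * y ^ 2 - μ * y + 2 * μ = 0 → 4 / 3 ≤ y := by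
    intro y hy0 hy
    by_contra hlt
    push Not at hlt
    have h1 : 0 < y ^ 2 * (4 - 3 * y) := mul_pos (by positivity) (by linarith)
    have h2 : 0 ≤ μ * (2 - y) := mul_nonneg hμ (by linarith)
    nlinarith
  refine ⟨x, ⟨by linarith, hx'⟩, ?_⟩
  rintro y ⟨hy0, hy⟩
  have hy1 := key y hy0 hy
  have hfac : (x - y) * (3 * (x ^ 2 + x * y + y ^ 2) - 4 * (x + y) + μ) = 0 := by
    linear_combination hy - hx'
  have hpos : 0 < 3 * (x ^ 2 + x * y + y ^ 2) - 4 * (x + y) + μ := by nlinarith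
  rcases mul_eq_zero.1 hfac with h | h
  · linarith
  · exact absurd h hpos.ne'

/-- For `μ ≥ 0`: the unique nonzero real solution of `-3 x³ + 4 x² - μ x + 2 μ = 0` (for `μ > 0`
it is the unique real solution, for `μ = 0` the only other solution is the double root `0`). -/
noncomputable def criticalG (μ : ℝ) : ℝ :=
  if hμ : 0 ≤ μ then (existsUnique_critical_root μ hμ).choose else 0

/-- The critical value `g_c(μ)` of the coupling constant. -/
noncomputable def criticalCoupling (μ : ℝ) : ℝ :=
  (criticalG μ - 1) / (criticalG μ ^ 2 * (criticalG μ ^ 2 + μ))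

/-- The amplitude `K(μ)` of the square-root singularity at `g_c(μ)`. -/
noncomputable def criticalK (μ : ℝ) : ℝ :=
  √(criticalG μ ^ 2 * (criticalG μ ^ 2 + μ) / (6 * criticalG μ ^ 2 + μ))

/-! A melonic 2-point graph is coded by a plane tree. Start at the root leg and follow its
propagator. Reaching the second leg gives a leaf. Reaching a tetrahedron gives a type I node with
four subtrees: one for each 2-point graph joining same-colour neighbours of the two paired nodes,
and one for the continuation beyond the second tetrahedron. Reaching a pillow of colour `l` gives a
type II node labelled `l` with two subtrees. The graph of a tree is `ofTree`. Existence of the code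
(`isIso_ofTree_insert`, `IsMelonic.exists_tree`) rests on the fact that inserting a melon adds one
node to the tree: a new root, or a node inside a subtree. Uniqueness
(`shape_eq_of_locallyIsomorphic`) rests on the relation `Reads`, which explores a graph from an end.
Explorations are transported by isomorphisms (`Reads.map`), and two explorations from the same end
with endpoint the second leg coincide (`Reads.compare`).

Hence isomorphism classes correspond to trees labelled by `Fin 3`, and classes up to pillow
recolouring to unlabelled trees. Decomposing a tree at its root gives G = 1 + X (G⁴ + μ G²) for the
unlabelled series, and the same equation at μ = 3 for labelled trees with weight 1, so that
`melonicGraphCount n` is the coefficient α_n(3).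

With B = G - 1 and φ(x) = (1 + x)² ((1 + x)² + μ) the equation reads B = X φ(B), so Lagrange
inversion gives n α_n = [x^(n-1)] φ^n. This coefficient is a Cauchy integral over the circle of
radius τ = G_c - 1. The cubic equation for G_c says τ φ'(τ) = φ(τ): the terms of φ(τ)/φ(τ) are
probability weights on the exponents with mean 1. A local limit theorem
(`tendsto_sqrt_mul_integral_trigSum_pow`) then yields the n^(-3/2) law with rate 1/g_c = φ(τ)/τ, the
variance τ² φ''(τ)/φ(τ) producing K. The numerical values follow from a bracketing of G_c(3). -/

namespace TwoPointGraph

/-! ### Isomorphisms between iterated insertions -/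

/-- The ends of `G`, seen in `G.insert a H`. -/
def leftEnd (G : TwoPointGraph) (a : G.End) (H : TwoPointGraph) : G.End → (G.insert a H).End :=
  Sum.map Sum.inl id

/-- The ends of `H`, seen in `G.insert a H`. -/
def rightEnd (G : TwoPointGraph) (a : G.End) (H : TwoPointGraph) : H.End → (G.insert a H).End :=
  insertRight G H a

section insert

variable {G H : TwoPointGraph} {a : G.End}

theorem leftEnd_injective : Function.Injective (leftEnd G a H) :=
  Sum.map_injective.2 ⟨Sum.inl_injective, Function.injective_id⟩

theorem line_rightEnd (y : H.End) :
    (G.insert a H).line (rightEnd G a H y) = rightEnd G a H (H.line y) :=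
  insertLine_right G H a y

theorem line_leftEnd {x : G.End} (h1 : x ≠ a) (h2 : x ≠ G.line a) :
    (G.insert a H).line (leftEnd G a H x) = leftEnd G a H (G.line x) :=
  (insertLine_left G H a x).trans (by rw [if_neg h1, if_neg h2]; rfl)

theorem rightEnd_root : rightEnd G a H (Sum.inr false) = leftEnd G a H a := rfl

theorem rightEnd_leg : rightEnd G a H (Sum.inr true) = leftEnd G a H (G.line a) := rfl

theorem end_cases (z : (G.insert a H).End) :
    (∃ y : H.End, z = rightEnd G a H y) ∨
      ∃ x : G.End, x ≠ a ∧ x ≠ G.line a ∧ z = leftEnd G a H x :=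
  insertLine_cases G H a z

theorem rightEnd_ne_leftEnd {x : G.End} (h1 : x ≠ a) (h2 : x ≠ G.line a) (y : H.End) :
    rightEnd G a H y ≠ leftEnd G a H x := by
  rcases y with y | _ | _
  · rcases x with x | x <;> intro h <;> cases h
  · rw [rightEnd_root]
    exact fun h => h1 (leftEnd_injective h).symm
  · rw [rightEnd_leg]
    exact fun h => h2 (leftEnd_injective h).symm

theorem line_ne_of_ne {x b : G.End} (h : x ≠ G.line b) : G.line x ≠ b :=
  fun h' => h (by rw [← h', G.line_line])

theorem line_injective (G : TwoPointGraph) : Function.Injective G.line :=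
  Function.LeftInverse.injective G.line_line

end insert

/-- Every end of an insertion comes from `H`, legs included, or from `G` off the cut propagator, so
the propagators need only be compared in these two cases. -/
theorem isRecoloring_insert {G H K : TwoPointGraph} {a : G.End} (e : (G.insert a H).V ≃ K.V)
    (π : (G.insert a H).V → Equiv.Perm (Fin 3))
    (E : (G.insert a H).End → K.End) (hE : E = Sum.map e id)
    (hG : ∀ x, x ≠ a → x ≠ G.line a →
      K.line (E (leftEnd G a H x)) = E (leftEnd G a H (G.line x)))
    (hH : ∀ y, K.line (E (rightEnd G a H y)) = E (rightEnd G a H (H.line y)))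
    (hb : ∀ c v, K.bond (π v c) (e v) = e ((G.insert a H).bond c v))
    (hc : ∀ c v, π ((G.insert a H).bond c v) = π v) :
    IsRecoloring (G.insert a H) K e π := by
  subst hE
  refine ⟨fun z => ?_, hb, hc⟩
  rcases end_cases z with ⟨y, rfl⟩ | ⟨x, h1, h2, rfl⟩
  · rw [hH, line_rightEnd]
  · rw [hG x h1 h2, line_leftEnd h1 h2]

theorem IsRecoloring.insert {G G' H H' : TwoPointGraph} {e : G.V ≃ G'.V} {f : H.V ≃ H'.V}
    {π : G.V → Equiv.Perm (Fin 3)} {ρ : H.V → Equiv.Perm (Fin 3)}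
    (h : IsRecoloring G G' e π) (k : IsRecoloring H H' f ρ) (a : G.End) :
    IsRecoloring (G.insert a H) (G'.insert (Sum.map e id a) H') (Equiv.sumCongr e f)
      (Sum.elim π ρ) := by
  let E : (G.insert a H).End → (G'.insert (Sum.map e id a) H').End :=
    Sum.map (Equiv.sumCongr e f) id
  have hl : ∀ x, E (leftEnd G a H x) =
      leftEnd G' (Sum.map e id a) H' (Sum.map e id x) := by rintro (x | x) <;> rfl
  have hr : ∀ y, E (rightEnd G a H y) =
      rightEnd G' (Sum.map e id a) H' (Sum.map f id y) := by
    rintro (y | _ | _)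
    · rfl
    · exact hl a
    · rw [rightEnd_leg, hl]
      show _ = leftEnd G' (Sum.map e id a) H' (G'.line (Sum.map e id a))
      rw [h.line]
  have he : Function.Injective (Sum.map e (id : Bool → Bool)) :=
    Sum.map_injective.2 ⟨e.injective, Function.injective_id⟩
  refine isRecoloring_insert _ _ E rfl (fun x h1 h2 => ?_) (fun y => ?_) ?_ ?_
  · rw [hl, hl]
    rw [line_leftEnd (fun h' => h1 (he h')) (fun h' => h2 (he (by rw [h', h.line]))), h.line]
  · rw [hr, hr]
    rw [line_rightEnd, k.line]
  · rintro c (v | v)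
    · exact congrArg Sum.inl (h.bond c v)
    · exact congrArg Sum.inr (k.bond c v)
  · rintro c (v | v)
    · exact h.const c v
    · exact k.const c v

/-- `e` is an isomorphism of two-point graphs. -/
def IsIso (G H : TwoPointGraph) (e : G.V ≃ H.V) : Prop := IsRecoloring G H e fun _ => 1

theorem IsIso.refl (G : TwoPointGraph) : IsIso G G (Equiv.refl _) := IsRecoloring.refl G

theorem IsIso.symm {G H : TwoPointGraph} {e : G.V ≃ H.V} (h : IsIso G H e) : IsIso H G e.symm := by
  simpa [IsIso] using IsRecoloring.symm h

theorem IsIso.trans {G H K : TwoPointGraph} {e : G.V ≃ H.V} {f : H.V ≃ K.V} (h : IsIso G H e)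
    (k : IsIso H K f) : IsIso G K (e.trans f) := by
  simpa [IsIso] using IsRecoloring.trans h k

theorem IsIso.insert {G G' H H' : TwoPointGraph} {e : G.V ≃ G'.V} {f : H.V ≃ H'.V}
    (h : IsIso G G' e) (k : IsIso H H' f) (a : G.End) :
    IsIso (G.insert a H) (G'.insert (Sum.map e id a) H') (Equiv.sumCongr e f) := by
  have := IsRecoloring.insert h k a
  rwa [show Sum.elim (fun _ : G.V => (1 : Equiv.Perm (Fin 3))) (fun _ : H.V => 1) = fun _ => 1 from
    funext fun x => by rcases x with x | x <;> rfl] at this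

/-- Exchange of the last two summands. -/
def sumRightComm (A B C : Type) : (A ⊕ B) ⊕ C ≃ (A ⊕ C) ⊕ B :=
  (Equiv.sumAssoc A B C).trans
    (((Equiv.refl A).sumCongr (Equiv.sumComm B C)).trans (Equiv.sumAssoc A C B).symm)

/-- Insertions on two different propagators commute. -/
theorem isIso_insert_comm (G H K : TwoPointGraph) {a b : G.End} (h1 : b ≠ a) (h2 : b ≠ G.line a) :
    IsIso ((G.insert a H).insert (leftEnd G a H b) K) ((G.insert b K).insert (leftEnd G b K a) H)
      (sumRightComm G.V H.V K.V) := by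
  have h3 : a ≠ G.line b := fun h => h2 (by rw [h, G.line_line])
  let E : ((G.insert a H).insert (leftEnd G a H b) K).End →
      ((G.insert b K).insert (leftEnd G b K a) H).End := Sum.map (sumRightComm G.V H.V K.V) id
  have hll : ∀ x, E (leftEnd (G.insert a H) (leftEnd G a H b) K (leftEnd G a H x)) =
      leftEnd (G.insert b K) (leftEnd G b K a) H (leftEnd G b K x) := by rintro (x | x) <;> rfl
  have hlr : ∀ y, E (leftEnd (G.insert a H) (leftEnd G a H b) K (rightEnd G a H y)) =
      rightEnd (G.insert b K) (leftEnd G b K a) H y := by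
    rintro (y | _ | _)
    · rfl
    · exact hll a
    · rw [rightEnd_leg, rightEnd_leg, hll, line_leftEnd h1.symm h3]
  have hr : ∀ y, E (rightEnd (G.insert a H) (leftEnd G a H b) K y) =
      leftEnd (G.insert b K) (leftEnd G b K a) H (rightEnd G b K y) := by
    rintro (y | _ | _)
    · rfl
    · exact hll b
    · rw [rightEnd_leg, rightEnd_leg, line_leftEnd h1 h2, hll]
  refine isRecoloring_insert _ _ E rfl (fun x hx1 hx2 => ?_) (fun y => ?_) ?_ ?_
  · rw [line_leftEnd h1 h2] at hx2
    rcases end_cases x with ⟨y, rfl⟩ | ⟨x, h4, h5, rfl⟩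
    · rw [line_rightEnd]
      rw [hlr, hlr]
      rw [line_rightEnd]
    · have h6 : x ≠ b := fun h => hx1 (by rw [h])
      have h7 : x ≠ G.line b := fun h => hx2 (by rw [h])
      rw [line_leftEnd h4 h5]
      rw [hll, hll]
      rw [line_leftEnd, line_leftEnd h6 h7]
      · exact fun h => h4 (leftEnd_injective h)
      · rw [line_leftEnd h1.symm h3]
        exact fun h => h5 (leftEnd_injective h)
  · rw [hr, hr]
    rw [line_leftEnd, line_rightEnd]
    · exact rightEnd_ne_leftEnd h1.symm h3 y
    · rw [line_leftEnd h1.symm h3]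
      refine rightEnd_ne_leftEnd (fun h => h2 h.symm) (fun h => h1 (G.line_injective h).symm) y
  · rintro c ((v | v) | v) <;> rfl
  · intro _ _; rfl

/-- Insertion on a propagator of an inserted graph. -/
theorem isIso_insert_assoc (G H K : TwoPointGraph) (a : G.End) (b : H.End) :
    IsIso ((G.insert a H).insert (rightEnd G a H b) K) (G.insert a (H.insert b K))
      (Equiv.sumAssoc G.V H.V K.V) := by
  let E : ((G.insert a H).insert (rightEnd G a H b) K).End →
      (G.insert a (H.insert b K)).End := Sum.map (Equiv.sumAssoc G.V H.V K.V) id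
  have hll : ∀ x, E (leftEnd (G.insert a H) (rightEnd G a H b) K (leftEnd G a H x)) =
      leftEnd G a (H.insert b K) x := by rintro (x | x) <;> rfl
  have hlr : ∀ y, E (leftEnd (G.insert a H) (rightEnd G a H b) K (rightEnd G a H y)) =
      rightEnd G a (H.insert b K) (leftEnd H b K y) := by
    rintro (y | _ | _)
    · rfl
    · exact hll a
    · exact hll (G.line a)
  have hr : ∀ y, E (rightEnd (G.insert a H) (rightEnd G a H b) K y) =
      rightEnd G a (H.insert b K) (rightEnd H b K y) := by
    rintro (y | _ | _)
    · rfl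
    · exact hlr b
    · rw [rightEnd_leg, rightEnd_leg, line_rightEnd, hlr]
  refine isRecoloring_insert _ _ E rfl (fun x hx1 hx2 => ?_) (fun y => ?_) ?_ ?_
  · rw [line_rightEnd] at hx2
    rcases end_cases x with ⟨y, rfl⟩ | ⟨x, h4, h5, rfl⟩
    · rw [line_rightEnd]
      rw [hlr, hlr]
      rw [line_rightEnd, line_leftEnd (fun h => hx1 (by rw [h])) (fun h => hx2 (by rw [h]))]
    · rw [line_leftEnd h4 h5]
      rw [hll, hll]
      rw [line_leftEnd h4 h5]
  · rw [hr, hr]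
    rw [line_rightEnd, line_rightEnd]
  · rintro c ((v | v) | v) <;> rfl
  · intro _ _; rfl

instance : IsEmpty bare.V := inferInstanceAs (IsEmpty Empty)

theorem isIso_insert_bare (G : TwoPointGraph) (a : G.End) :
    IsIso (G.insert a bare) G (Equiv.sumEmpty G.V bare.V) := by
  let E : (G.insert a bare).End → G.End := Sum.map (Equiv.sumEmpty G.V bare.V) id
  have hl : ∀ x, E (leftEnd G a bare x) = x := by
    rintro (x | x) <;> rfl
  refine isRecoloring_insert _ _ E rfl (fun x _ _ => ?_) (fun y => ?_) ?_ ?_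
  · rw [hl, hl]
  · rcases y with y | _ | _
    · exact isEmptyElim y
    · show G.line (E (leftEnd G a bare a)) = E (leftEnd G a bare (G.line a))
      rw [hl, hl]
    · show G.line (E (leftEnd G a bare (G.line a))) = E (leftEnd G a bare a)
      rw [hl, hl]
      rw [G.line_line]
  · rintro c (v | v)
    · rfl
    · exact isEmptyElim v
  · intro _ _; rfl

/-- The composition of two-point graphs, seen as an insertion in either of them. -/
theorem isIso_insert_root (G H : TwoPointGraph) :
    IsIso (G.insert (Sum.inr false) H) (H.insert (H.line (Sum.inr true)) G)
      (Equiv.sumComm G.V H.V) := by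
  let E : (G.insert (Sum.inr false) H).End → (H.insert (H.line (Sum.inr true)) G).End :=
    Sum.map (Equiv.sumComm G.V H.V) id
  have hl : ∀ x, x ≠ Sum.inr false → E (leftEnd G (Sum.inr false) H x) =
      rightEnd H (H.line (Sum.inr true)) G x := by
    rintro (x | _ | _) hx
    · rfl
    · exact absurd rfl hx
    · rw [rightEnd_leg, H.line_line]; rfl
  have hr : ∀ y, y ≠ Sum.inr true → E (rightEnd G (Sum.inr false) H y) =
      leftEnd H (H.line (Sum.inr true)) G y := by
    rintro (y | _ | _) hy
    · rfl
    · rfl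
    · exact absurd rfl hy
  have hr' : E (rightEnd G (Sum.inr false) H (Sum.inr true)) =
      rightEnd H (H.line (Sum.inr true)) G (G.line (Sum.inr false)) := by
    rw [rightEnd_leg, hl _ (G.line_ne _)]
  refine isRecoloring_insert _ _ E rfl (fun x hx1 hx2 => ?_) (fun y => ?_) ?_ ?_
  · rw [hl _ hx1, hl _ (line_ne_of_ne hx2)]
    rw [line_rightEnd]
  · by_cases h1 : y = Sum.inr true
    · rw [h1]
      rw [hr', hr _ (H.line_ne _)]
      rw [line_rightEnd, G.line_line, rightEnd_root]
    · by_cases h2 : y = H.line (Sum.inr true)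
      · rw [h2, H.line_line]
        rw [hr', hr _ (H.line_ne _)]
        rw [← rightEnd_root, line_rightEnd]
      · rw [hr _ h1, hr _ (line_ne_of_ne h2)]
        rw [line_leftEnd h2]
        rwa [H.line_line]
  · rintro c (v | v) <;> rfl
  · intro _ _; rfl

/-- Inserting `H` with the opposite orientation, when `H` is symmetric under the exchange of its
external legs. -/
theorem isIso_insert_line (G : TwoPointGraph) {H : TwoPointGraph} (a : G.End) (f : H.V ≃ H.V)
    (hline : ∀ x, H.line (Sum.map f not x) = Sum.map f not (H.line x))
    (hbond : ∀ c v, H.bond c (f v) = f (H.bond c v)) :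
    IsIso (G.insert a H) (G.insert (G.line a) H) ((Equiv.refl G.V).sumCongr f) := by
  let E : (G.insert a H).End → (G.insert (G.line a) H).End :=
    Sum.map ((Equiv.refl G.V).sumCongr f) id
  have hl : ∀ x, E (leftEnd G a H x) = leftEnd G (G.line a) H x := by rintro (x | x) <;> rfl
  have hr : ∀ y, E (rightEnd G a H y) = rightEnd G (G.line a) H (Sum.map f not y) := by
    rintro (y | _ | _)
    · rfl
    · show E (leftEnd G a H a) = leftEnd G (G.line a) H (G.line (G.line a))
      rw [hl, G.line_line]
    · exact hl _
  refine isRecoloring_insert _ _ E rfl (fun x hx1 hx2 => ?_) (fun y => ?_) ?_ ?_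
  · rw [hl, hl]
    rw [line_leftEnd hx2 (by rwa [G.line_line])]
  · rw [hr, hr]
    rw [line_rightEnd, hline]
  · rintro c (v | v)
    · rfl
    · exact congrArg Sum.inr (hbond c v)
  · intro _ _; rfl

/-- The elementary melons, of type I for `none` and of type II and colour `l` for `some l`. -/
def melon : Option (Fin 3) → TwoPointGraph
  | none => melonI
  | some l => melonII l

/-- Elementary melons have no orientation: type I is symmetric under the exchange of its two
tetrahedra, type II under the flip of the second coordinate, and both symmetries swap the legs and
keep all colours. -/
theorem isIso_insert_melon_line (G : TwoPointGraph) (a : G.End) (m : Option (Fin 3)) :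
    ∃ e, IsIso (G.insert a (melon m)) (G.insert (G.line a) (melon m)) e := by
  rcases m with _ | l
  · refine ⟨_, isIso_insert_line (H := melonI) G a
      (Equiv.boolNot.prodCongr (Equiv.refl (Bool × Bool))) ?_ ?_⟩
    · rintro (⟨_ | _, _ | _, _ | _⟩ | _ | _) <;> rfl
    · rintro c ⟨_ | _, _ | _, _ | _⟩ <;> rfl
  · refine ⟨_, isIso_insert_line (H := melonII l) G a
      ((Equiv.refl Bool).prodCongr Equiv.boolNot) ?_ ?_⟩
    · rintro (⟨_ | _, _ | _⟩ | _ | _) <;> rfl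
    · rintro c ⟨b, b'⟩
      show pillowBond l c (b, !b') = ((pillowBond l c (b, b')).1, !(pillowBond l c (b, b')).2)
      unfold pillowBond
      split_ifs <;> rfl

end TwoPointGraph

/-! ### Melon trees and the graphs they code -/

/-- Plane trees with ternary branchings followed by a continuation (type I) and unary branchings
followed by a continuation (type II), the latter being labelled by `L`. -/
inductive MelonTree (L : Type) : Type
  | leaf : MelonTree L
  | nodeI : MelonTree L → MelonTree L → MelonTree L → MelonTree L → MelonTree L
  | nodeII : L → MelonTree L → MelonTree L → MelonTree L

namespace MelonTree

variable {L : Type}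

/-- The number of nodes of type I. -/
def countI : MelonTree L → ℕ
  | leaf => 0
  | nodeI a b c d => a.countI + b.countI + c.countI + d.countI + 1
  | nodeII _ a b => a.countI + b.countI

/-- The number of nodes of type II. -/
def countII : MelonTree L → ℕ
  | leaf => 0
  | nodeI a b c d => a.countII + b.countII + c.countII + d.countII
  | nodeII _ a b => a.countII + b.countII + 1

/-- The tree without its labels. -/
def shape : MelonTree L → MelonTree Unit
  | leaf => leaf
  | nodeI a b c d => nodeI a.shape b.shape c.shape d.shape
  | nodeII _ a b => nodeII () a.shape b.shape

theorem countI_shape (t : MelonTree L) : t.shape.countI = t.countI := by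
  induction t with
  | leaf => rfl
  | nodeI a b c d ha hb hc hd => simp [shape, countI, ha, hb, hc, hd]
  | nodeII l a b ha hb => simp [shape, countI, ha, hb]

theorem countII_shape (t : MelonTree L) : t.shape.countII = t.countII := by
  induction t with
  | leaf => rfl
  | nodeI a b c d ha hb hc hd => simp [shape, countII, ha, hb, hc, hd]
  | nodeII l a b ha hb => simp [shape, countII, ha, hb]

end MelonTree

namespace TwoPointGraph

/-- Successive insertions on propagators of `M`, given by one of their ends, together with the
inclusion of the nodes of `M`. -/
noncomputable def fill (M : TwoPointGraph) :
    List (M.End × TwoPointGraph) → Σ X : TwoPointGraph, M.V → X.V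
  | [] => ⟨M, id⟩
  | s :: r => ⟨(fill M r).1.insert (Sum.map (fill M r).2 id s.1) s.2, Sum.inl ∘ (fill M r).2⟩

/-- The ends of `M`, seen in `fill M r`. -/
noncomputable def fillEnd (M : TwoPointGraph) (r : List (M.End × TwoPointGraph)) :
    M.End → (fill M r).1.End :=
  Sum.map (fill M r).2 id

section fill

variable {M : TwoPointGraph}

theorem fillEnd_nil (x : M.End) : fillEnd M [] x = x := by rcases x with x | x <;> rfl

theorem fillEnd_cons (s : M.End × TwoPointGraph) (r : List (M.End × TwoPointGraph)) (x : M.End) :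
    fillEnd M (s :: r) x = leftEnd (fill M r).1 (fillEnd M r s.1) s.2 (fillEnd M r x) := by
  rcases x with x | x <;> rfl

theorem fill_injective (r : List (M.End × TwoPointGraph)) : Function.Injective (fill M r).2 := by
  induction r with
  | nil => exact Function.injective_id
  | cons s r ih => exact Sum.inl_injective.comp ih

theorem fillEnd_injective (r : List (M.End × TwoPointGraph)) :
    Function.Injective (fillEnd M r) :=
  Sum.map_injective.2 ⟨fill_injective r, Function.injective_id⟩

theorem fill_bond (r : List (M.End × TwoPointGraph)) (c : Fin 3) (v : M.V) :
    (fill M r).1.bond c ((fill M r).2 v) = (fill M r).2 (M.bond c v) := by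
  induction r with
  | nil => rfl
  | cons s r ih => exact congrArg Sum.inl ih

/-- `x` is not an end of the propagator `{y, line y}`. -/
def OffLine (G : TwoPointGraph) (x y : G.End) : Prop := x ≠ y ∧ x ≠ G.line y

theorem OffLine.symm {G : TwoPointGraph} {x y : G.End} (h : G.OffLine x y) : G.OffLine y x :=
  ⟨h.1.symm, fun h' => h.2 (by rw [h', G.line_line])⟩

theorem OffLine.line {G : TwoPointGraph} {x y : G.End} (h : G.OffLine x y) :
    G.OffLine (G.line x) y :=
  ⟨line_ne_of_ne h.2, fun h' => h.1 (G.line_injective h')⟩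

/-- Insertions on propagators of `M` cut only these, so any other propagator of `M` survives.
Pairwise disjointness also ensures that each insertion finds its own propagator still uncut. -/
theorem line_fillEnd (r : List (M.End × TwoPointGraph)) (x : M.End)
    (hx : ∀ s ∈ r, M.OffLine x s.1) (hr : r.Pairwise fun s s' => M.OffLine s.1 s'.1) :
    (fill M r).1.line (fillEnd M r x) = fillEnd M r (M.line x) := by
  induction r generalizing x with
  | nil => rw [fillEnd_nil, fillEnd_nil]; rfl
  | cons s r ih =>
    rw [List.pairwise_cons] at hr
    have hs := hx s (by simp)
    rw [fillEnd_cons, fillEnd_cons]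
    refine (line_leftEnd (fun h => hs.1 (fillEnd_injective r h)) (fun h => hs.2 ?_)).trans ?_
    · rw [ih s.1 hr.1 hr.2] at h
      exact fillEnd_injective r h
    · rw [ih x (fun s' hs' => hx s' (by simp [hs'])) hr.2]

theorem IsIso.insert_right (G : TwoPointGraph) {H H' : TwoPointGraph} {f : H.V ≃ H'.V}
    (h : IsIso H H' f) (a : G.End) :
    IsIso (G.insert a H) (G.insert a H') ((Equiv.refl G.V).sumCongr f) := by
  have := (IsIso.refl G).insert h a
  rwa [show Sum.map (Equiv.refl G.V) id a = a by rcases a with a | a <;> rfl] at this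

/-- `r'` is obtained from `r` by replacing one second component by a related one. -/
inductive ReplaceOne {α β : Type*} (step : β → β → Prop) : List (α × β) → List (α × β) → Prop
  | head {a : α} {b b' : β} {r : List (α × β)} (h : step b b') :
      ReplaceOne step ((a, b) :: r) ((a, b') :: r)
  | tail {s : α × β} {r r' : List (α × β)} (h : ReplaceOne step r r') :
      ReplaceOne step (s :: r) (s :: r')

/-- An end of the filled graph lies either on an unfilled propagator of `M` or in one of the
inserted graphs. In the second case the insertion takes place inside that graph: by associativity
for the graph inserted last, by commutation of insertions for the others. Compatibility of `e` with
the inclusion of `M` is what makes the induction close. -/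
theorem fill_insert {α : Type*} (g : α → TwoPointGraph) (m : TwoPointGraph) (step : α → α → Prop)
    (r : List (M.End × α))
    (h : ∀ s ∈ r, ∀ y, ∃ b, step s.2 b ∧ ∃ e, IsIso ((g s.2).insert y m) (g b) e)
    (hr : r.Pairwise fun s s' => M.OffLine s.1 s'.1)
    (z : (fill M (r.map (Prod.map id g))).1.End) :
    (∃ x, z = fillEnd M (r.map (Prod.map id g)) x ∧ ∀ s ∈ r, M.OffLine x s.1) ∨
      ∃ r', ReplaceOne step r r' ∧
        ∃ e, IsIso ((fill M (r.map (Prod.map id g))).1.insert z m)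
            (fill M (r'.map (Prod.map id g))).1 e ∧
          ∀ v, e (Sum.inl ((fill M (r.map (Prod.map id g))).2 v)) =
            (fill M (r'.map (Prod.map id g))).2 v := by
  induction r with
  | nil => exact Or.inl ⟨z, (fillEnd_nil z).symm, by simp⟩
  | cons s r ih =>
    obtain ⟨z₀, b⟩ := s
    rw [List.pairwise_cons] at hr
    have hline : (fill M (r.map (Prod.map id g))).1.line (fillEnd M (r.map (Prod.map id g)) z₀) =
        fillEnd M (r.map (Prod.map id g)) (M.line z₀) := by
      refine line_fillEnd _ _ ?_ ?_
      · intro s hs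
        obtain ⟨s', hs', rfl⟩ := List.mem_map.1 hs
        exact hr.1 s' hs'
      · rw [List.pairwise_map]
        exact hr.2
    rcases end_cases z with ⟨y, rfl⟩ | ⟨x, hx1, hx2, rfl⟩
    · obtain ⟨b', hb', e, he⟩ := h _ (List.mem_cons_self) y
      exact Or.inr ⟨(z₀, b') :: r, ReplaceOne.head hb', _,
        (isIso_insert_assoc _ _ _ _ _).trans (he.insert_right _ _), fun v => rfl⟩
    · rcases ih (fun s hs => h s (List.mem_cons_of_mem _ hs)) hr.2 x with
        ⟨x, rfl, hx⟩ | ⟨r', hr', e, he, hev⟩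
      · refine Or.inl ⟨x, (fillEnd_cons (z₀, g b) _ x).symm, fun s hs => ?_⟩
        rcases List.mem_cons.1 hs with rfl | hs
        · exact ⟨fun h' => hx1 (congrArg _ h'), fun h' => hx2 ((congrArg _ h').trans hline.symm)⟩
        · exact hx s hs
      · have key := (isIso_insert_comm _ (g b) m hx1 hx2).trans
          (he.insert (IsIso.refl (g b)) (leftEnd _ x m (fillEnd M (r.map (Prod.map id g)) z₀)))
        have hz : Sum.map e id (leftEnd _ x m (fillEnd M (r.map (Prod.map id g)) z₀)) =
            fillEnd M (r'.map (Prod.map id g)) z₀ := by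
          rcases z₀ with v | v
          · exact congrArg Sum.inl (hev v)
          · rfl
        rw [hz] at key
        exact Or.inr ⟨(z₀, b) :: r', ReplaceOne.tail hr', _, key,
          fun v => congrArg Sum.inl (hev v)⟩

end fill

/-- The node of the first tetrahedron of `melonI` joined to the root node by the colour `c`. -/
def slotI (c : Fin 3) : melonI.End := Sum.inl (false, tetraBond c (false, false))

/-- The propagators of `melonI` other than the root one, with the subtrees inserted there. -/
def slotsI {α : Type*} (a b c d : α) : List (melonI.End × α) :=
  [(slotI 0, a), (slotI 1, b), (slotI 2, c), (Sum.inl (true, (false, false)), d)]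

/-- The propagators of `melonII l` other than the root one, with the subtrees inserted there. -/
def slotsII {α : Type*} (l : Fin 3) (a b : α) : List ((melonII l).End × α) :=
  [(Sum.inl (true, false), a), (Sum.inl (false, true), b)]

/-- The melonic graph coded by a tree. -/
noncomputable def ofTree : MelonTree (Fin 3) → TwoPointGraph
  | .leaf => bare
  | .nodeI a b c d => (fill melonI (slotsI (ofTree a) (ofTree b) (ofTree c) (ofTree d))).1
  | .nodeII l a b => (fill (melonII l) (slotsII l (ofTree a) (ofTree b))).1

instance : DecidableEq melonI.V := inferInstanceAs (DecidableEq (Bool × (Bool × Bool)))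
instance (l : Fin 3) : DecidableEq (melonII l).V := inferInstanceAs (DecidableEq (Bool × Bool))
instance : Fintype melonI.V := inferInstanceAs (Fintype (Bool × (Bool × Bool)))
instance (l : Fin 3) : Fintype (melonII l).V := inferInstanceAs (Fintype (Bool × Bool))
instance (x y : melonI.End) : Decidable (melonI.OffLine x y) :=
  inferInstanceAs (Decidable (x ≠ y ∧ x ≠ melonI.line y))
instance (l : Fin 3) (x y : (melonII l).End) : Decidable ((melonII l).OffLine x y) :=
  inferInstanceAs (Decidable (x ≠ y ∧ x ≠ (melonII l).line y))

theorem slotsI_pairwise {α : Type*} (a b c d : α) :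
    (slotsI a b c d).Pairwise fun s s' => melonI.OffLine s.1 s'.1 := by
  simp only [slotsI, List.pairwise_cons, List.mem_cons, List.not_mem_nil, forall_eq_or_imp]
  simp
  decide

theorem slotsII_pairwise {α : Type*} (l : Fin 3) (a b : α) :
    (slotsII l a b).Pairwise fun s s' => (melonII l).OffLine s.1 s'.1 := by
  simp only [slotsII, List.pairwise_cons, List.mem_cons, List.not_mem_nil, forall_eq_or_imp]
  simp
  revert l
  decide

/-- The four slots and the root propagator exhaust the propagators of `melonI`. -/
theorem eq_root_of_offLine_slotsI {α : Type*} {a b c d : α} {x : melonI.End}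
    (h : ∀ s ∈ slotsI a b c d, melonI.OffLine x s.1) :
    x = Sum.inr false ∨ x = melonI.line (Sum.inr false) := by
  simp only [slotsI, List.mem_cons, List.not_mem_nil, forall_eq_or_imp] at h
  obtain ⟨h1, h2, h3, h4, -⟩ := h
  revert x
  decide

theorem eq_root_of_offLine_slotsII {α : Type*} {l : Fin 3} {a b : α} {x : (melonII l).End}
    (h : ∀ s ∈ slotsII l a b, (melonII l).OffLine x s.1) :
    x = Sum.inr false ∨ x = (melonII l).line (Sum.inr false) := by
  simp only [slotsII, List.mem_cons, List.not_mem_nil, forall_eq_or_imp] at h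
  obtain ⟨h1, h2, -⟩ := h
  revert l x
  decide

end TwoPointGraph

/-! ### Melonic graphs are exactly the graphs of trees -/

namespace TwoPointGraph

/-- The tree with a root node and leaves, followed by `t`. -/
def consMelon : Option (Fin 3) → MelonTree (Fin 3) → MelonTree (Fin 3)
  | none, t => .nodeI .leaf .leaf .leaf t
  | some l, t => .nodeII l .leaf t

/-- The contribution of a melon to the number of melons of type I. -/
def oneI : Option (Fin 3) → ℕ
  | none => 1
  | some _ => 0

/-- The contribution of a melon to the number of melons of type II. -/
def oneII : Option (Fin 3) → ℕ
  | none => 0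
  | some _ => 1

/-- `t'` has one more node than `t`, of the type of `melon m`. -/
def OneMore (m : Option (Fin 3)) (t t' : MelonTree (Fin 3)) : Prop :=
  t'.countI = t.countI + oneI m ∧ t'.countII = t.countII + oneII m

theorem oneMore_consMelon (m : Option (Fin 3)) (t : MelonTree (Fin 3)) :
    OneMore m t (consMelon m t) := by
  rcases m with _ | l <;> simp [OneMore, consMelon, oneI, oneII, MelonTree.countI,
    MelonTree.countII]

theorem isIso_ofTree_insert_root (m : Option (Fin 3)) (t : MelonTree (Fin 3)) :
    ∃ e, IsIso ((ofTree t).insert (Sum.inr false) (melon m)) (ofTree (consMelon m t)) e := by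
  rcases m with _ | l
  -- The old graph becomes the continuation of the new melon. The three remaining slots are filled
  -- with bare propagators, which changes nothing up to isomorphism.
  · have h1 := isIso_insert_root (ofTree t) melonI
    let G₁ := melonI.insert (melonI.line (Sum.inr true)) (ofTree t)
    have h2 := isIso_insert_bare G₁ (Sum.map Sum.inl id (slotI 2))
    let G₂ := G₁.insert (Sum.map Sum.inl id (slotI 2)) bare
    have h3 := isIso_insert_bare G₂ (Sum.map (Sum.inl ∘ Sum.inl) id (slotI 1))
    let G₃ := G₂.insert (Sum.map (Sum.inl ∘ Sum.inl) id (slotI 1)) bare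
    have h4 := isIso_insert_bare G₃ (Sum.map (Sum.inl ∘ Sum.inl ∘ Sum.inl) id (slotI 0))
    exact ⟨_, h1.trans (h2.symm.trans (h3.symm.trans h4.symm))⟩
  · have h1 := isIso_insert_root (ofTree t) (melonII l)
    have h2 := isIso_insert_bare
      ((melonII l).insert ((melonII l).line (Sum.inr true)) (ofTree t))
      (Sum.inl (Sum.inl (true, false)))
    exact ⟨_, h1.trans h2.symm⟩

theorem isIso_ofTree_insert (m : Option (Fin 3)) (t : MelonTree (Fin 3)) (z : (ofTree t).End) :
    ∃ t', OneMore m t t' ∧ ∃ e, IsIso ((ofTree t).insert z (melon m)) (ofTree t') e := by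
  have root : ∀ t, ∀ z, (z = Sum.inr false ∨ z = (ofTree t).line (Sum.inr false)) →
      ∃ t', OneMore m t t' ∧ ∃ e, IsIso ((ofTree t).insert z (melon m)) (ofTree t') e := by
    rintro t z (rfl | rfl)
    · exact ⟨_, oneMore_consMelon m t, isIso_ofTree_insert_root m t⟩
    -- Here the root propagator is given by its other end, so the insertion has the opposite
    -- orientation.
    · obtain ⟨e, he⟩ := isIso_insert_melon_line (ofTree t) (Sum.inr false) m
      obtain ⟨f, hf⟩ := isIso_ofTree_insert_root m t
      exact ⟨_, oneMore_consMelon m t, _, he.symm.trans hf⟩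
  induction t with
  | leaf =>
    refine root _ _ ?_
    rcases z with z | _ | _
    · exact isEmptyElim (α := bare.V) z
    · exact Or.inl rfl
    · exact Or.inr rfl
  | nodeI a b c d ha hb hc hd =>
    -- Either the melon is inserted on the root propagator and creates a new root, or it is absorbed
    -- by one of the four subtrees.
    rcases fill_insert ofTree (melon m) (OneMore m) (slotsI a b c d)
      (by simp only [slotsI, List.mem_cons, List.not_mem_nil, forall_eq_or_imp]
          exact ⟨ha, hb, hc, hd, by simp⟩) (slotsI_pairwise a b c d) z with
      ⟨x, rfl, hx⟩ | ⟨r', hr', e, he, -⟩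
    · refine root (.nodeI a b c d) _ ?_
      have hline := line_fillEnd ((slotsI a b c d).map (Prod.map id ofTree)) (Sum.inr false)
        (by
          simp only [slotsI, List.map, List.mem_cons, List.not_mem_nil, forall_eq_or_imp]
          simp [Prod.map]
          decide) (slotsI_pairwise (ofTree a) (ofTree b) (ofTree c) (ofTree d))
      rcases eq_root_of_offLine_slotsI hx with rfl | rfl
      · exact Or.inl rfl
      · exact Or.inr hline.symm
    · rcases hr' with h | (h | (h | (h | h)))
      · rename_i b'
        refine ⟨.nodeI b' b c d, ?_, e, he⟩
        simp only [OneMore, MelonTree.countI, MelonTree.countII] at h ⊢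
        omega
      · rename_i b'
        refine ⟨.nodeI a b' c d, ?_, e, he⟩
        simp only [OneMore, MelonTree.countI, MelonTree.countII] at h ⊢
        omega
      · rename_i b'
        refine ⟨.nodeI a b b' d, ?_, e, he⟩
        simp only [OneMore, MelonTree.countI, MelonTree.countII] at h ⊢
        omega
      · rename_i b'
        refine ⟨.nodeI a b c b', ?_, e, he⟩
        simp only [OneMore, MelonTree.countI, MelonTree.countII] at h ⊢
        omega
      · cases h
  | nodeII l a b ha hb =>
    rcases fill_insert ofTree (melon m) (OneMore m) (slotsII l a b)
      (by simp only [slotsII, List.mem_cons, List.not_mem_nil, forall_eq_or_imp]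
          exact ⟨ha, hb, by simp⟩) (slotsII_pairwise l a b) z with
      ⟨x, rfl, hx⟩ | ⟨r', hr', e, he, -⟩
    · refine root (.nodeII l a b) _ ?_
      have hline := line_fillEnd ((slotsII l a b).map (Prod.map id ofTree)) (Sum.inr false)
        (by
          simp only [slotsII, List.map, List.mem_cons, List.not_mem_nil, forall_eq_or_imp]
          have : ∀ l, (melonII l).OffLine (Sum.inr false) (Sum.inl (true, false)) ∧
            (melonII l).OffLine (Sum.inr false) (Sum.inl (false, true)) := by decide
          exact ⟨(this l).1, (this l).2, by simp⟩) (slotsII_pairwise l (ofTree a) (ofTree b))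
      rcases eq_root_of_offLine_slotsII hx with rfl | rfl
      · exact Or.inl rfl
      · exact Or.inr hline.symm
    · rcases hr' with h | (h | h)
      · rename_i b'
        refine ⟨.nodeII l b' b, ?_, e, he⟩
        simp only [OneMore, MelonTree.countI, MelonTree.countII] at h ⊢
        omega
      · rename_i b'
        refine ⟨.nodeII l a b', ?_, e, he⟩
        simp only [OneMore, MelonTree.countI, MelonTree.countII] at h ⊢
        omega
      · cases h

theorem IsMelonic.exists_tree {p q : ℕ} {G : TwoPointGraph} (hG : IsMelonic p q G) :
    ∃ t, t.countI = p ∧ t.countII = q ∧ ∃ e, IsIso G (ofTree t) e := by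
  have step : ∀ {p q : ℕ} {G : TwoPointGraph} (a : G.End) (m : Option (Fin 3)),
      (∃ t, t.countI = p ∧ t.countII = q ∧ ∃ e, IsIso G (ofTree t) e) →
      ∃ t, t.countI = p + oneI m ∧ t.countII = q + oneII m ∧
        ∃ e, IsIso (G.insert a (melon m)) (ofTree t) e := by
    rintro p q G a m ⟨t, rfl, rfl, e, he⟩
    obtain ⟨t', ht', f, hf⟩ := isIso_ofTree_insert m t (Sum.map e id a)
    exact ⟨t', ht'.1, ht'.2, _, (he.insert (IsIso.refl (melon m)) a).trans hf⟩
  induction hG with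
  | bare => exact ⟨.leaf, rfl, rfl, _, IsIso.refl _⟩
  | insertI _ a ih => exact step a none ih
  | insertII _ a l ih => exact step a (some l) ih

/-- `G` is isomorphic to a melonic graph. -/
def IsMelonicUpToIso (p q : ℕ) (G : TwoPointGraph) : Prop :=
  ∃ H, IsMelonic p q H ∧ ∃ e, IsIso H G e

theorem IsMelonicUpToIso.of_isIso {p q : ℕ} {G H : TwoPointGraph} {e : G.V ≃ H.V}
    (hG : IsMelonicUpToIso p q G) (h : IsIso G H e) : IsMelonicUpToIso p q H := by
  obtain ⟨K, hK, f, hf⟩ := hG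
  exact ⟨K, hK, _, hf.trans h⟩

theorem IsMelonicUpToIso.cast {p q p' q' : ℕ} {G : TwoPointGraph}
    (hG : IsMelonicUpToIso p q G) (hp : p = p') (hq : q = q') : IsMelonicUpToIso p' q' G :=
  hp ▸ hq ▸ hG

theorem IsMelonicUpToIso.insert_melon {p q : ℕ} {G : TwoPointGraph}
    (hG : IsMelonicUpToIso p q G) (a : G.End) (m : Option (Fin 3)) :
    IsMelonicUpToIso (p + oneI m) (q + oneII m) (G.insert a (melon m)) := by
  obtain ⟨K, hK, f, hf⟩ := hG
  have h := hf.insert (IsIso.refl (melon m)) (Sum.map f.symm id a)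
  rw [show Sum.map f id (Sum.map f.symm id a) = a by rcases a with a | a <;> simp] at h
  rcases m with _ | l
  · exact ⟨_, hK.insertI _, _, h⟩
  · exact ⟨_, hK.insertII _ l, _, h⟩

/-- Insert into `G` the melons that build `H` one by one: by associativity each goes on a propagator
of the copy of `H` already present. -/
theorem IsMelonicUpToIso.insert {p q p' q' : ℕ} {G H : TwoPointGraph}
    (hG : IsMelonicUpToIso p q G) (hH : IsMelonicUpToIso p' q' H) (a : G.End) :
    IsMelonicUpToIso (p + p') (q + q') (G.insert a H) := by
  obtain ⟨K, hK, f, hf⟩ := hH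
  refine IsMelonicUpToIso.of_isIso ?_ (hf.insert_right G a)
  clear hf f
  induction hK with
  | bare => exact hG.of_isIso (isIso_insert_bare G a).symm
  | insertI _ b ih =>
    exact (ih.insert_melon (rightEnd G a _ b) none).of_isIso (isIso_insert_assoc _ _ _ _ _)
  | insertII _ b l ih =>
    exact (ih.insert_melon (rightEnd G a _ b) (some l)).of_isIso (isIso_insert_assoc _ _ _ _ _)

theorem isMelonicUpToIso_melon (m : Option (Fin 3)) :
    IsMelonicUpToIso (oneI m) (oneII m) (melon m) := by
  have h : IsMelonicUpToIso 0 0 bare := ⟨_, .bare, _, IsIso.refl _⟩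
  have := ((h.insert_melon (Sum.inr false) m).of_isIso (isIso_insert_root bare (melon m))).of_isIso
    (isIso_insert_bare _ _)
  simpa using this

theorem isMelonicUpToIso_ofTree (t : MelonTree (Fin 3)) :
    IsMelonicUpToIso t.countI t.countII (ofTree t) := by
  induction t with
  | leaf => exact ⟨_, .bare, _, IsIso.refl _⟩
  | nodeI a b c d ha hb hc hd =>
    -- The maps `Sum.inl ∘ id` and their iterates are the inclusions of `fill` unfolded, so that the
    -- result is `ofTree` by definition.
    have := ((((isMelonicUpToIso_melon none).insert hd
      (Sum.map id id (Sum.inl (true, (false, false))))).insert hc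
      (Sum.map (Sum.inl ∘ id) id (slotI 2))).insert hb
      (Sum.map (Sum.inl ∘ Sum.inl ∘ id) id (slotI 1))).insert ha
      (Sum.map (Sum.inl ∘ Sum.inl ∘ Sum.inl ∘ id) id (slotI 0))
    exact this.cast (by simp only [MelonTree.countI, oneI]; omega)
      (by simp only [MelonTree.countII, oneII]; omega)
  | nodeII l a b ha hb =>
    have := ((isMelonicUpToIso_melon (some l)).insert hb
      (Sum.map id id (Sum.inl (false, true)))).insert ha
      (Sum.map (Sum.inl ∘ id) id (Sum.inl (true, false)))
    exact this.cast (by simp only [MelonTree.countI, oneI]; omega)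
      (by simp only [MelonTree.countII, oneII]; omega)

/-! ### Recolouring the pillows -/

/-- `e` and `π` form an isomorphism up to local colour permutations at the pillows. -/
def IsLocalIso (G H : TwoPointGraph) (e : G.V ≃ H.V) (π : G.V → Equiv.Perm (Fin 3)) : Prop :=
  IsRecoloring G H e π ∧ ∀ v, ¬ G.IsPillowNode v → π v = 1

theorem IsLocalIso.insert {G G' H H' : TwoPointGraph} {e : G.V ≃ G'.V} {f : H.V ≃ H'.V}
    {π : G.V → Equiv.Perm (Fin 3)} {ρ : H.V → Equiv.Perm (Fin 3)}
    (h : IsLocalIso G G' e π) (k : IsLocalIso H H' f ρ) (a : G.End) :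
    IsLocalIso (G.insert a H) (G'.insert (Sum.map e id a) H') (Equiv.sumCongr e f)
      (Sum.elim π ρ) := by
  refine ⟨h.1.insert k.1 a, ?_⟩
  rintro (v | v) hv
  · refine h.2 v fun ⟨l, h1, h2⟩ => hv ⟨l, fun c d hc hd => ?_, fun c hc => ?_⟩
    · exact ⟨congrArg Sum.inl (h1 c d hc hd).1, congrArg Sum.inl (h1 c d hc hd).2⟩
    · exact ⟨fun h' => (h2 c hc).1 (Sum.inl_injective h'), congrArg Sum.inl (h2 c hc).2⟩
  · refine k.2 v fun ⟨l, h1, h2⟩ => hv ⟨l, fun c d hc hd => ?_, fun c hc => ?_⟩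
    · exact ⟨congrArg Sum.inr (h1 c d hc hd).1, congrArg Sum.inr (h1 c d hc hd).2⟩
    · exact ⟨fun h' => (h2 c hc).1 (Sum.inr_injective h'), congrArg Sum.inr (h2 c hc).2⟩

theorem isLocalIso_refl (G : TwoPointGraph) : IsLocalIso G G (Equiv.refl _) fun _ => 1 :=
  ⟨IsRecoloring.refl G, fun _ _ => rfl⟩

theorem isPillowNode_melonII (l : Fin 3) (v : (melonII l).V) : (melonII l).IsPillowNode v := by
  refine ⟨l, ?_, ?_⟩
  · show ∀ c d, c ≠ l → d ≠ l → pillowBond l c v = pillowBond l d v ∧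
      pillowBond l c (pillowBond l l v) = pillowBond l d (pillowBond l l v)
    intro c d hc hd
    simp [pillowBond, hc, hd]
  · show ∀ c, c ≠ l → pillowBond l c v ≠ pillowBond l l v ∧
      pillowBond l c (pillowBond l l v) = pillowBond l l (pillowBond l c v)
    intro c hc
    simp [pillowBond, hc, Prod.ext_iff]

/-- Pillows of different colours share their nodes and propagators. The transposition of `l` and
`l'` carries the distinguished colour of one to that of the other, and the two remaining colours
play the same role. -/
theorem isLocalIso_melonII (l l' : Fin 3) :
    IsLocalIso (melonII l) (melonII l') (Equiv.refl (Bool × Bool)) fun _ => Equiv.swap l l' := by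
  refine ⟨⟨?_, ?_, fun _ _ => rfl⟩, fun v hv => absurd (isPillowNode_melonII l v) hv⟩
  · rintro (⟨_ | _, _ | _⟩ | _ | _) <;> rfl
  · intro c v
    show pillowBond l' (Equiv.swap l l' c) v = pillowBond l c v
    have : Equiv.swap l l' c = l' ↔ c = l := by
      rw [Equiv.swap_apply_eq_iff, Equiv.swap_apply_right]
    simp [pillowBond, this]

theorem isLocalIso_ofTree (t t' : MelonTree (Fin 3)) (h : t.shape = t'.shape) :
    ∃ e π, IsLocalIso (ofTree t) (ofTree t') e π := by
  induction t generalizing t' with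
  | leaf =>
    cases t' with
    | leaf => exact ⟨_, _, isLocalIso_refl _⟩
    | nodeI => simp [MelonTree.shape] at h
    | nodeII => simp [MelonTree.shape] at h
  | nodeI a b c d ha hb hc hd =>
    cases t' with
    | leaf => simp [MelonTree.shape] at h
    | nodeI a' b' c' d' =>
      simp only [MelonTree.shape, MelonTree.nodeI.injEq] at h
      obtain ⟨_, _, h1⟩ := ha a' h.1
      obtain ⟨_, _, h2⟩ := hb b' h.2.1
      obtain ⟨_, _, h3⟩ := hc c' h.2.2.1
      obtain ⟨_, _, h4⟩ := hd d' h.2.2.2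
      exact ⟨_, _, ((((isLocalIso_refl melonI).insert h4
        (Sum.map id id (Sum.inl (true, (false, false))))).insert h3
        (Sum.map (Sum.inl ∘ id) id (slotI 2))).insert h2
        (Sum.map (Sum.inl ∘ Sum.inl ∘ id) id (slotI 1))).insert h1
        (Sum.map (Sum.inl ∘ Sum.inl ∘ Sum.inl ∘ id) id (slotI 0))⟩
    | nodeII => simp [MelonTree.shape] at h
  | nodeII l a b ha hb =>
    cases t' with
    | leaf => simp [MelonTree.shape] at h
    | nodeI => simp [MelonTree.shape] at h
    | nodeII l' a' b' =>
      simp only [MelonTree.shape, MelonTree.nodeII.injEq] at h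
      obtain ⟨_, _, h1⟩ := ha a' h.2.1
      obtain ⟨_, _, h2⟩ := hb b' h.2.2
      exact ⟨_, _, ((isLocalIso_melonII l l').insert h2
        (Sum.map id id (Sum.inl (false, true)))).insert h1
        (Sum.map (Sum.inl ∘ id) id (Sum.inl (true, false)))⟩

end TwoPointGraph

/-! ### Recovering the tree from the graph -/

namespace TwoPointGraph

theorem fin_three_add_ne (l : Fin 3) : l + 1 ≠ l ∧ l + 2 ≠ l ∧ l + 1 ≠ l + 2 := by
  revert l; decide

theorem exists_fin_three_ne (l l' : Fin 3) : ∃ d, d ≠ l ∧ d ≠ l' := by revert l l'; decide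

/-- The three neighbours of `v` in its bubble are distinct. -/
def IsTetraNode (G : TwoPointGraph) (v : G.V) : Prop := Function.Injective fun c => G.bond c v

/-- The two edges at `v` of colours different from `l` have the same other end. -/
def IsPillowOf (G : TwoPointGraph) (l : Fin 3) (v : G.V) : Prop :=
  (∀ c d, c ≠ l → d ≠ l → G.bond c v = G.bond d v) ∧ ∀ c, c ≠ l → G.bond c v ≠ G.bond l v

/-- A set of nodes which is a union of bubbles. -/
def BondClosed (G : TwoPointGraph) (S : Set G.V) : Prop := ∀ c, ∀ v ∈ S, G.bond c v ∈ S

theorem IsTetraNode.not_isPillowNode {G : TwoPointGraph} {v : G.V} (hv : G.IsTetraNode v) :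
    ¬ G.IsPillowNode v := by
  rintro ⟨l, h, -⟩
  obtain ⟨h1, h2, h3⟩ := fin_three_add_ne l
  exact h3 (hv (h _ _ h1 h2).1)

theorem IsTetraNode.not_isPillowOf {G : TwoPointGraph} {v : G.V} (hv : G.IsTetraNode v)
    (l : Fin 3) : ¬ G.IsPillowOf l v := by
  rintro ⟨h, -⟩
  obtain ⟨h1, h2, h3⟩ := fin_three_add_ne l
  exact h3 (hv (h _ _ h1 h2))

theorem IsPillowOf.unique {G : TwoPointGraph} {v : G.V} {l l' : Fin 3} (h : G.IsPillowOf l v)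
    (h' : G.IsPillowOf l' v) : l = l' := by
  by_contra hne
  obtain ⟨d, hd, hd'⟩ := exists_fin_three_ne l l'
  exact h'.2 d hd' (h.1 d l' hd (Ne.symm hne))

/-- `Reads G t x y S`: following the propagator of the end `x` and exploring `G`, one reads the
tree `t` before reaching the end `y`, and only nodes of `S` are met in between. -/
inductive Reads (G : TwoPointGraph) : MelonTree (Fin 3) → G.End → G.End → Set G.V → Prop
  | leaf {x : G.End} {S : Set G.V} (hS : G.BondClosed S) : Reads G .leaf x (G.line x) S
  | nodeI {x y : G.End} {v w : G.V} {t : Fin 3 → MelonTree (Fin 3)} {d : MelonTree (Fin 3)}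
      {T : Fin 3 → Set G.V} {U S : Set G.V} (hx : G.line x = Sum.inl v)
      (hv : G.IsTetraNode v) (hw : G.IsTetraNode w)
      (ht : ∀ c, Reads G (t c) (Sum.inl (G.bond c v)) (Sum.inl (G.bond c w)) (T c))
      (hT : ∀ c c', c ≠ c' → Disjoint (T c) (T c')) (hwT : ∀ c, w ∉ T c)
      (hd : Reads G d (Sum.inl w) y U) (hS : G.BondClosed S) (hvS : v ∈ S) (hwS : w ∈ S)
      (hTS : ∀ c, T c ⊆ S) (hUS : U ⊆ S) : Reads G (.nodeI (t 0) (t 1) (t 2) d) x y S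
  | nodeII {x y : G.End} {v : G.V} {l : Fin 3} {a b : MelonTree (Fin 3)} {T U S : Set G.V}
      (hx : G.line x = Sum.inl v) (hv : G.IsPillowOf l v)
      (ha : Reads G a (Sum.inl (G.bond l v)) (Sum.inl (G.bond l (G.bond (l + 1) v))) T)
      (hvT : v ∉ T) (hb : Reads G b (Sum.inl (G.bond (l + 1) v)) y U)
      (hS : G.BondClosed S) (hvS : v ∈ S) (hTS : T ⊆ S) (hUS : U ⊆ S) :
      Reads G (.nodeII l a b) x y S

theorem Reads.bondClosed {G : TwoPointGraph} {t : MelonTree (Fin 3)} {x y : G.End} {S : Set G.V}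
    (h : Reads G t x y S) : G.BondClosed S := by
  cases h <;> assumption

theorem BondClosed.mem_of_bond {G : TwoPointGraph} {S : Set G.V} (hS : G.BondClosed S) {c : Fin 3}
    {v : G.V} (h : G.bond c v ∈ S) : v ∈ S := by
  simpa [G.bond_bond] using hS c _ h

/-- Two explorations from the same end agree, unless one is longer than the other. -/
theorem Reads.compare {G : TwoPointGraph} {t t' : MelonTree (Fin 3)} {x y y' : G.End}
    {S S' : Set G.V} (h : Reads G t x y S) (h' : Reads G t' x y' S') :
    (t = t' ∧ y = y') ∨ (∃ u ∈ S', y = Sum.inl u) ∨ ∃ u ∈ S, y' = Sum.inl u := by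
  induction h generalizing t' y' S' with
  | leaf hS =>
    cases h' with
    | leaf => exact Or.inl ⟨rfl, rfl⟩
    | nodeI hx _ _ _ _ _ _ _ hvS => exact Or.inr (Or.inl ⟨_, hvS, hx⟩)
    | nodeII hx _ _ _ _ _ hvS => exact Or.inr (Or.inl ⟨_, hvS, hx⟩)
  | @nodeI x y v w t d T U S hx hv hw ht hT hwT hd hS hvS hwS hTS hUS ih ihd =>
    cases h' with
    | leaf => exact Or.inr (Or.inr ⟨_, hvS, hx⟩)
    | @nodeI _ _ v' w' t' d' T' U' _ hx' hv' hw' ht' hT' hwT' hd' hS' hvS' hwS' hTS' hUS' =>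
      obtain rfl : v = v' := Sum.inl_injective (hx.symm.trans hx')
      -- The node `w` paired with `v` is not determined by the bubble of `v`. Each colour gives
      -- either equality of the partners or one partner inside a region of the other exploration,
      -- since regions are unions of bubbles.
      have key : ∀ c, (t c = t' c ∧ w = w') ∨ w ∈ T' c ∨ w' ∈ T c := by
        intro c
        rcases ih c (ht' c) with ⟨h1, h2⟩ | ⟨u, hu, h2⟩ | ⟨u, hu, h2⟩
        · refine Or.inl ⟨h1, ?_⟩
          rw [← G.bond_bond c w, Sum.inl_injective h2, G.bond_bond]
        · rw [← Sum.inl_injective h2] at hu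
          exact Or.inr (Or.inl ((ht' c).bondClosed.mem_of_bond hu))
        · rw [← Sum.inl_injective h2] at hu
          exact Or.inr (Or.inr ((ht c).bondClosed.mem_of_bond hu))
      by_cases hww : w = w'
      · subst hww
        have ht : ∀ c, t c = t' c := fun c => by
          rcases key c with h | h | h
          · exact h.1
          · exact absurd h (hwT' c)
          · exact absurd h (hwT c)
        rcases ihd hd' with ⟨h1, h2⟩ | ⟨u, hu, h2⟩ | ⟨u, hu, h2⟩
        · exact Or.inl ⟨by rw [ht, ht, ht, h1], h2⟩
        · exact Or.inr (Or.inl ⟨u, hUS' hu, h2⟩)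
        · exact Or.inr (Or.inr ⟨u, hUS hu, h2⟩)
      -- Pigeonhole: among three colours two fall on the same side, so `w` lies in two of the
      -- disjoint regions `T'`, or `w'` in two of the disjoint regions `T`.
      · exfalso
        have key' : ∀ c, w ∈ T' c ∨ w' ∈ T c := fun c =>
          (key c).resolve_left fun h => hww h.2
        have h1 : ∀ c c', c ≠ c' → w ∈ T' c → w ∉ T' c' := fun c c' hc h h' =>
          Set.disjoint_left.1 (hT' c c' hc) h h'
        have h2 : ∀ c c', c ≠ c' → w' ∈ T c → w' ∉ T c' := fun c c' hc h h' =>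
          Set.disjoint_left.1 (hT c c' hc) h h'
        have h01 : (0 : Fin 3) ≠ 1 := by decide
        have h02 : (0 : Fin 3) ≠ 2 := by decide
        have h12 : (1 : Fin 3) ≠ 2 := by decide
        rcases key' 0 with a | a <;> rcases key' 1 with b | b <;> rcases key' 2 with c | c
        · exact h1 0 1 h01 a b
        · exact h1 0 1 h01 a b
        · exact h1 0 2 h02 a c
        · exact h2 1 2 h12 b c
        · exact h1 1 2 h12 b c
        · exact h2 0 2 h02 a c
        · exact h2 0 1 h01 a b
        · exact h2 0 1 h01 a b
    | nodeII hx' hv' =>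
      rw [hx] at hx'
      rw [← Sum.inl_injective hx'] at hv'
      exact absurd hv' (hv.not_isPillowOf _)
  | @nodeII x y v l a b T U S hx hv ha hvT hb hS hvS hTS hUS iha ihb =>
    cases h' with
    | leaf => exact Or.inr (Or.inr ⟨_, hvS, hx⟩)
    | nodeI hx' hv' =>
      rw [hx] at hx'
      rw [← Sum.inl_injective hx'] at hv'
      exact absurd hv (hv'.not_isPillowOf _)
    | @nodeII _ _ v' l' a' b' T' U' _ hx' hv' ha' hvT' hb' hS' hvS' hTS' hUS' =>
      obtain rfl : v = v' := Sum.inl_injective (hx.symm.trans hx')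
      obtain rfl := hv.unique hv'
      -- If one reading of the far pair stopped inside the other, its endpoint would put `v`, which
      -- is in the same bubble, into a region that avoids `v`.
      rcases iha ha' with ⟨rfl, -⟩ | ⟨u, hu, h2⟩ | ⟨u, hu, h2⟩
      · rcases ihb hb' with ⟨h1, h2⟩ | ⟨u, hu, h2⟩ | ⟨u, hu, h2⟩
        · exact Or.inl ⟨by rw [h1], h2⟩
        · exact Or.inr (Or.inl ⟨u, hUS' hu, h2⟩)
        · exact Or.inr (Or.inr ⟨u, hUS hu, h2⟩)
      · rw [← Sum.inl_injective h2] at hu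
        exact absurd (ha'.bondClosed.mem_of_bond (ha'.bondClosed.mem_of_bond hu)) hvT'
      · rw [← Sum.inl_injective h2] at hu
        exact absurd (ha.bondClosed.mem_of_bond (ha.bondClosed.mem_of_bond hu)) hvT

/-- Explorations are transported by embeddings, up to colour permutations. -/
theorem Reads.map {G H : TwoPointGraph} (F : G.End → H.End) (e : G.V → H.V)
    (he : Function.Injective e) (hF : ∀ v, F (Sum.inl v) = Sum.inl (e v))
    (π : G.V → Equiv.Perm (Fin 3)) (hb : ∀ c v, H.bond (π v c) (e v) = e (G.bond c v))
    (hc : ∀ c v, π (G.bond c v) = π v) (hπ : ∀ v, G.IsTetraNode v → π v = 1)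
    {t : MelonTree (Fin 3)} {x y : G.End} {S : Set G.V} (h : Reads G t x y S)
    (hline : ∀ u, (u = x ∨ ∃ s ∈ S, u = Sum.inl s) → H.line (F u) = F (G.line u)) :
    ∃ t' : MelonTree (Fin 3), t'.shape = t.shape ∧ ((∀ v, π v = 1) → t' = t) ∧
      Reads H t' (F x) (F y) (e '' S) := by
  have hclosed : ∀ {S}, G.BondClosed S → H.BondClosed (e '' S) := by
    rintro S hS c _ ⟨v, hv, rfl⟩
    obtain ⟨c, rfl⟩ := (π v).surjective c
    exact ⟨_, hS c v hv, (hb c v).symm⟩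
  have htetra : ∀ {v}, G.IsTetraNode v → ∀ c, H.bond c (e v) = e (G.bond c v) := by
    intro v hv c
    simpa [hπ v hv] using hb c v
  have htetra' : ∀ {v}, G.IsTetraNode v → H.IsTetraNode (e v) := by
    intro v hv c d hcd
    simp only [htetra hv] at hcd
    exact hv (he hcd)
  induction h with
  | @leaf x S hS =>
    refine ⟨.leaf, rfl, fun _ => rfl, ?_⟩
    rw [← hline x (Or.inl rfl)]
    exact .leaf (hclosed hS)
  | @nodeI x y v w t d T U S hx hv hw ht hT hwT hd hS hvS hwS hTS hUS ih ihd =>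
    have h1 : ∀ c, ∃ t' : MelonTree (Fin 3), t'.shape = (t c).shape ∧
        ((∀ v, π v = 1) → t' = t c) ∧
        Reads H t' (F (Sum.inl (G.bond c v))) (F (Sum.inl (G.bond c w))) (e '' T c) := by
      refine fun c => ih c fun u hu => hline u (Or.inr ?_)
      rcases hu with rfl | ⟨s, hs, rfl⟩
      · exact ⟨_, hS c v hvS, rfl⟩
      · exact ⟨s, hTS c hs, rfl⟩
    choose t' ht'1 ht'2 ht'3 using h1
    obtain ⟨d', hd'1, hd'2, hd'3⟩ := ihd fun u hu => hline u (Or.inr (by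
      rcases hu with rfl | ⟨s, hs, rfl⟩
      · exact ⟨_, hwS, rfl⟩
      · exact ⟨s, hUS hs, rfl⟩))
    refine ⟨.nodeI (t' 0) (t' 1) (t' 2) d', ?_, fun hp => ?_, ?_⟩
    · simp only [MelonTree.shape, ht'1, hd'1]
    · simp only [ht'2 _ hp, hd'2 hp]
    · refine .nodeI (v := e v) (w := e w) (T := fun c => e '' T c) (U := e '' U) ?_ (htetra' hv)
        (htetra' hw) (fun c => ?_) (fun c c' hc => ?_) (fun c => ?_) ?_ (hclosed hS)
        (Set.mem_image_of_mem _ hvS) (Set.mem_image_of_mem _ hwS)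
        (fun c => Set.image_mono (hTS c)) (Set.image_mono hUS)
      · rw [hline x (Or.inl rfl), hx, hF]
      · rw [htetra hv, htetra hw, ← hF, ← hF]
        exact ht'3 c
      · exact (Set.disjoint_image_iff he).2 (hT c c' hc)
      · rw [he.mem_set_image]
        exact hwT c
      · rw [← hF]
        exact hd'3
  | @nodeII x y v l a b T U S hx hv ha hvT hb' hS hvS hTS hUS iha ihb =>
    have hpil : H.IsPillowOf (π v l) (e v) := by
      constructor
      · intro c d hc hd
        obtain ⟨c, rfl⟩ := (π v).surjective c
        obtain ⟨d, rfl⟩ := (π v).surjective d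
        rw [hb, hb, hv.1 c d (fun h => hc (by rw [h])) (fun h => hd (by rw [h]))]
      · intro c hc
        obtain ⟨c, rfl⟩ := (π v).surjective c
        rw [hb, hb]
        exact fun h => hv.2 c (fun h => hc (by rw [h])) (he h)
    have hnext : H.bond (π v l + 1) (e v) = e (G.bond (l + 1) v) := by
      rw [hpil.1 (π v l + 1) (π v (l + 1)) (fin_three_add_ne _).1
        (fun h => (fin_three_add_ne l).1 ((π v).injective h)), hb]
    have hfar : H.bond (π v l) (H.bond (π v l + 1) (e v)) = e (G.bond l (G.bond (l + 1) v)) := by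
      rw [hnext, ← hc (l + 1) v, hb]
    obtain ⟨a', ha'1, ha'2, ha'3⟩ := iha fun u hu => hline u (Or.inr (by
      rcases hu with rfl | ⟨s, hs, rfl⟩
      · exact ⟨_, hS _ v hvS, rfl⟩
      · exact ⟨s, hTS hs, rfl⟩))
    obtain ⟨b', hb'1, hb'2, hb'3⟩ := ihb fun u hu => hline u (Or.inr (by
      rcases hu with rfl | ⟨s, hs, rfl⟩
      · exact ⟨_, hS _ v hvS, rfl⟩
      · exact ⟨s, hUS hs, rfl⟩))
    refine ⟨.nodeII (π v l) a' b', ?_, fun hp => ?_, ?_⟩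
    · simp only [MelonTree.shape, ha'1, hb'1]
    · rw [ha'2 hp, hb'2 hp, hp v]
      rfl
    · refine .nodeII (v := e v) (T := e '' T) (U := e '' U) ?_ hpil ?_ ?_ ?_ (hclosed hS)
        (Set.mem_image_of_mem _ hvS) (Set.image_mono hTS) (Set.image_mono hUS)
      · rw [hline x (Or.inl rfl), hx, hF]
      · rw [hfar, hb, ← hF, ← hF]
        exact ha'3
      · rwa [he.mem_set_image]
      · rw [hnext, ← hF]
        exact hb'3

/-- Each inserted graph is read between the two ends of its slot. The regions read in different
slots are disjoint and contain no node of `M`; these are the side conditions of `Reads.nodeI` and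
`Reads.nodeII`. -/
theorem exists_reads_fill {M : TwoPointGraph} (r : List (M.End × MelonTree (Fin 3)))
    (h : ∀ s ∈ r, Reads (ofTree s.2) s.2 (Sum.inr false) (Sum.inr true) Set.univ)
    (hr : r.Pairwise fun s s' => M.OffLine s.1 s'.1) :
    ∃ S : M.End → Set (fill M (r.map (Prod.map id ofTree))).1.V,
      (∀ s ∈ r, Reads (fill M (r.map (Prod.map id ofTree))).1 s.2
        (fillEnd M (r.map (Prod.map id ofTree)) s.1)
        (fillEnd M (r.map (Prod.map id ofTree)) (M.line s.1)) (S s.1)) ∧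
      (∀ s ∈ r, ∀ v, (fill M (r.map (Prod.map id ofTree))).2 v ∉ S s.1) ∧
      ∀ s ∈ r, ∀ s' ∈ r, s.1 ≠ s'.1 → Disjoint (S s.1) (S s'.1) := by
  classical
  induction r with
  | nil => exact ⟨fun _ => ∅, by simp, by simp, by simp⟩
  | cons s₀ r ih =>
    rw [List.pairwise_cons] at hr
    obtain ⟨S, hS1, hS2, hS3⟩ := ih (fun s hs => h s (List.mem_cons_of_mem _ hs)) hr.2
    have hline : (fill M (r.map (Prod.map id ofTree))).1.line
        (fillEnd M (r.map (Prod.map id ofTree)) s₀.1) =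
        fillEnd M (r.map (Prod.map id ofTree)) (M.line s₀.1) := by
      refine line_fillEnd _ _ ?_ ?_
      · intro s hs
        obtain ⟨s', hs', rfl⟩ := List.mem_map.1 hs
        exact hr.1 s' hs'
      · rw [List.pairwise_map]
        exact hr.2
    let iL : (fill M (r.map (Prod.map id ofTree))).1.V →
      (fill M ((s₀ :: r).map (Prod.map id ofTree))).1.V := Sum.inl
    let iR : (ofTree s₀.2).V → (fill M ((s₀ :: r).map (Prod.map id ofTree))).1.V := Sum.inr
    have hiL : Function.Injective iL := Sum.inl_injective
    have hiR : Function.Injective iR := Sum.inr_injective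
    obtain ⟨S', hS'0, hS'⟩ : ∃ S' : M.End → Set (fill M ((s₀ :: r).map (Prod.map id ofTree))).1.V,
        S' s₀.1 = Set.range iR ∧ ∀ z, z ≠ s₀.1 → S' z = iL '' S z :=
      ⟨fun z => if z = s₀.1 then Set.range iR else iL '' S z, if_pos rfl, fun z hz => if_neg hz⟩
    have hmem : ∀ s ∈ s₀ :: r, s = s₀ ∨ (s ∈ r ∧ s.1 ≠ s₀.1) := fun s hs =>
      (List.mem_cons.1 hs).imp_right fun hs => ⟨hs, (hr.1 s hs).symm.1⟩
    have hcons : ∀ x, fillEnd M ((s₀ :: r).map (Prod.map id ofTree)) x =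
        leftEnd _ (fillEnd M (r.map (Prod.map id ofTree)) s₀.1) (ofTree s₀.2)
          (fillEnd M (r.map (Prod.map id ofTree)) x) :=
      fillEnd_cons (Prod.map id ofTree s₀) _
    refine ⟨S', ?_, ?_, ?_⟩
    · intro s hs
      rcases hmem s hs with rfl | ⟨hs', hne⟩
      · rw [hS'0]
        obtain ⟨t', -, ht', hR⟩ := (h s (by simp)).map
          (H := (fill M ((s :: r).map (Prod.map id ofTree))).1) (rightEnd _ _ _) iR
          hiR (fun _ => rfl) (fun _ => 1) (fun _ _ => rfl) (fun _ _ => rfl)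
          (fun _ _ => rfl) (fun u _ => line_rightEnd u)
        rw [ht' fun _ => rfl, rightEnd_root, rightEnd_leg, Set.image_univ] at hR
        have hR' : Reads _ s.2
            (leftEnd _ _ (ofTree s.2) (fillEnd M (r.map (Prod.map id ofTree)) s.1))
            (leftEnd _ _ (ofTree s.2) ((fill M (r.map (Prod.map id ofTree))).1.line
              (fillEnd M (r.map (Prod.map id ofTree)) s.1))) (Set.range iR) := hR
        rw [hline] at hR'
        rw [hcons, hcons]
        exact hR'
      · rw [hS' _ hne]
        obtain ⟨t', -, ht', hR⟩ := (hS1 s hs').map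
          (H := (fill M ((s₀ :: r).map (Prod.map id ofTree))).1)
          (leftEnd _ (fillEnd M (r.map (Prod.map id ofTree)) s₀.1) _) iL
          hiL (fun _ => rfl) (fun _ => 1) (fun _ _ => rfl) (fun _ _ => rfl)
          (fun _ _ => rfl) (by
            intro u hu
            -- The new insertion alters only the propagator of `s₀.1`. None of the ends met when
            -- reading the slot `s.1` lies on it, which is all that `Reads.map` requires.
            have hz : ∀ z, M.OffLine z s.1 → u ≠ fillEnd M (r.map (Prod.map id ofTree)) z := by
              rintro z hz rfl
              rcases hu with hu | ⟨v, hv, hu⟩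
              · exact hz.1 (fillEnd_injective _ hu)
              · rcases z with z | z
                · exact hS2 s hs' z (by
                    have := Sum.inl_injective hu
                    rwa [← this] at hv)
                · cases hu
            refine line_leftEnd (hz _ (hr.1 s hs')) ?_
            exact fun h => hz _ (hr.1 s hs').line (h.trans hline))
        rw [ht' fun _ => rfl] at hR
        rw [hcons, hcons]
        exact hR
    · rintro s hs v hv
      rcases hmem s hs with rfl | ⟨hs', hne⟩
      · rw [hS'0] at hv
        obtain ⟨x, hx⟩ := hv
        cases hx
      · rw [hS' _ hne] at hv
        obtain ⟨x, hx, hxv⟩ := hv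
        exact hS2 s hs' v (hiL hxv ▸ hx)
    · rintro s hs s' hs' hne
      have hd : ∀ A, Disjoint (Set.range iR) (iL '' A) := by
        intro A
        rw [Set.disjoint_left]
        rintro _ ⟨x, rfl⟩ ⟨y, -, hy⟩
        cases hy
      rcases hmem s hs with rfl | ⟨h1, h1'⟩ <;> rcases hmem s' hs' with rfl | ⟨h2, h2'⟩
      · exact absurd rfl hne
      · rw [hS'0, hS' _ h2']
        exact hd _
      · rw [hS'0, hS' _ h1']
        exact (hd _).symm
      · rw [hS' _ h1', hS' _ h2']
        exact (Set.disjoint_image_iff hiL).2 (hS3 s h1 s' h2 hne)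

/-- The node of `melonI` attached to the root leg. -/
def rootI : melonI.V := (false, (false, false))

/-- The node of `melonI` attached to the second leg. -/
def exitI : melonI.V := (true, (false, false))

/-- The node of `melonII l` attached to the root leg. -/
def rootII (l : Fin 3) : (melonII l).V := (false, false)

theorem isTetraNode_melonI (v : melonI.V) : melonI.IsTetraNode v := by
  obtain ⟨b, v⟩ := v
  have : ∀ (v : Bool × Bool) (c c' : Fin 3), tetraBond c v = tetraBond c' v → c = c' := by decide
  exact fun c c' h => this v c c' (congrArg Prod.snd h)

theorem line_slotI (c : Fin 3) : melonI.line (slotI c) = Sum.inl (melonI.bond c exitI) := by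
  revert c
  decide

theorem slotI_ne {c c' : Fin 3} (h : c ≠ c') : slotI c ≠ slotI c' := by
  revert c c'
  decide

theorem bond_rootII {l c : Fin 3} (h : c ≠ l) : (melonII l).bond c (rootII l) = (false, true) :=
  if_neg h

theorem bond_rootII_self (l : Fin 3) : (melonII l).bond l (rootII l) = (true, false) :=
  if_pos rfl

theorem line_slotII (l : Fin 3) : (melonII l).line (Sum.inl ((melonII l).bond l (rootII l))) =
    Sum.inl ((melonII l).bond l ((melonII l).bond (l + 1) (rootII l))) := by
  revert l
  decide

theorem mem_slotsI {α : Type*} (t : Fin 3 → α) (d : α) (c : Fin 3) :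
    (slotI c, t c) ∈ slotsI (t 0) (t 1) (t 2) d := by
  fin_cases c <;> simp [slotsI]

/-- The tree is read back from its graph, from leg to leg. This is the canonical exploration with
which all others are compared. -/
theorem reads_ofTree (t : MelonTree (Fin 3)) :
    Reads (ofTree t) t (Sum.inr false) (Sum.inr true) Set.univ := by
  have huniv : ∀ G : TwoPointGraph, G.BondClosed Set.univ := fun _ _ _ _ => trivial
  induction t with
  | leaf => exact .leaf (huniv _)
  | nodeI a b c d ha hb hc hd =>
    obtain ⟨S, hS1, hS2, hS3⟩ := exists_reads_fill (slotsI a b c d)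
      (by simp only [slotsI, List.mem_cons, List.not_mem_nil, forall_eq_or_imp]
          exact ⟨ha, hb, hc, hd, by simp⟩) (slotsI_pairwise a b c d)
    have hroot : (fill melonI ((slotsI a b c d).map (Prod.map id ofTree))).1.line (Sum.inr false) =
        Sum.inl ((fill melonI ((slotsI a b c d).map (Prod.map id ofTree))).2 rootI) := by
      refine (line_fillEnd _ (Sum.inr false) ?_
        (slotsI_pairwise (ofTree a) (ofTree b) (ofTree c) (ofTree d)))
      simp only [slotsI, List.map, List.mem_cons, List.not_mem_nil, forall_eq_or_imp]
      simp [Prod.map]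
      decide
    have htetra : ∀ v, (fill melonI ((slotsI a b c d).map (Prod.map id ofTree))).1.IsTetraNode
        ((fill melonI ((slotsI a b c d).map (Prod.map id ofTree))).2 v) := by
      intro v c c' h
      simp only [fill_bond] at h
      exact isTetraNode_melonI v (fill_injective _ h)
    have hmem := mem_slotsI ![a, b, c] d
    have hmem' : (Sum.inl exitI, d) ∈ slotsI a b c d := by simp [slotsI, exitI]
    refine .nodeI (t := ![a, b, c]) (T := fun c => S (slotI c)) (U := S (Sum.inl exitI))
      hroot (htetra rootI) (htetra exitI) (fun i => ?_) (fun i j hij => ?_) (fun i => ?_) ?_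
      (huniv _) trivial trivial (fun _ => Set.subset_univ _) (Set.subset_univ _)
    · have := hS1 _ (hmem i)
      rw [line_slotI] at this
      rw [fill_bond, fill_bond]
      exact this
    · exact hS3 _ (hmem i) _ (hmem j) (slotI_ne hij)
    · exact hS2 _ (hmem i) _
    · exact hS1 _ hmem'
  | nodeII l a b ha hb =>
    obtain ⟨S, hS1, hS2, hS3⟩ := exists_reads_fill (slotsII l a b)
      (by simp only [slotsII, List.mem_cons, List.not_mem_nil, forall_eq_or_imp]
          exact ⟨ha, hb, by simp⟩) (slotsII_pairwise l a b)
    have hroot : (fill (melonII l) ((slotsII l a b).map (Prod.map id ofTree))).1.line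
        (Sum.inr false) =
        Sum.inl ((fill (melonII l) ((slotsII l a b).map (Prod.map id ofTree))).2 (rootII l)) := by
      refine (line_fillEnd _ (Sum.inr false) ?_ (slotsII_pairwise l (ofTree a) (ofTree b)))
      simp only [slotsII, List.map, List.mem_cons, List.not_mem_nil, forall_eq_or_imp]
      have : ∀ l, (melonII l).OffLine (Sum.inr false) (Sum.inl (true, false)) ∧
        (melonII l).OffLine (Sum.inr false) (Sum.inl (false, true)) := by decide
      exact ⟨(this l).1, (this l).2, by simp⟩
    have hl := (fin_three_add_ne l).1
    have h1 : (Sum.inl ((melonII l).bond l (rootII l)), a) ∈ slotsII l a b := by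
      rw [bond_rootII_self]; simp [slotsII]
    have h2 : (Sum.inl ((melonII l).bond (l + 1) (rootII l)), b) ∈ slotsII l a b := by
      rw [bond_rootII hl]; simp [slotsII]
    refine .nodeII (v := (fill (melonII l) ((slotsII l a b).map (Prod.map id ofTree))).2 (rootII l))
      (T := S (Sum.inl ((melonII l).bond l (rootII l))))
      (U := S (Sum.inl ((melonII l).bond (l + 1) (rootII l)))) hroot ⟨fun c d hc hd => ?_,
        fun c hc => ?_⟩ ?_ ?_ ?_
      (huniv _) trivial (Set.subset_univ _) (Set.subset_univ _)
    · rw [fill_bond, fill_bond, bond_rootII hc, bond_rootII hd]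
    · rw [fill_bond, fill_bond, bond_rootII hc, bond_rootII_self]
      refine fun h => ?_
      have := congrArg Prod.fst (fill_injective _ h)
      cases this
    · have := hS1 _ h1
      rw [line_slotII] at this
      rw [fill_bond, fill_bond, fill_bond]
      exact this
    · exact hS2 _ h1 _
    · have := hS1 _ h2
      rw [fill_bond]
      -- The slot of the continuation ends at the second leg, which is where the whole reading
      -- stops.
      refine Eq.subst (motive := fun z => Reads _ _ _ z _) ?_ this
      have h3 : (melonII l).line (Sum.inl ((melonII l).bond (l + 1) (rootII l))) =
          Sum.inr true := by
        rw [bond_rootII hl]; rfl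
      dsimp only
      rw [h3]
      rfl

/-- Transport the reading of `t` to `ofTree t'`. Tetrahedral nodes are not pillow nodes, so only the
labels of type II nodes can change on the way. -/
theorem shape_eq_of_locallyIsomorphic {t t' : MelonTree (Fin 3)}
    {e : (ofTree t).V ≃ (ofTree t').V} {π : (ofTree t).V → Equiv.Perm (Fin 3)}
    (h : IsLocalIso (ofTree t) (ofTree t') e π) :
    t.shape = t'.shape ∧ ((∀ v, π v = 1) → t = t') := by
  obtain ⟨t'', h1, h2, h3⟩ := (reads_ofTree t).map (H := ofTree t') (Sum.map e id) e e.injective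
    (fun _ => rfl) π h.1.bond h.1.const (fun v hv => h.2 v hv.not_isPillowNode)
    (fun u _ => h.1.line u)
  -- Both explorations stop at the second leg, which is not a node, so neither can be longer than
  -- the other.
  rcases h3.compare (reads_ofTree t') with ⟨rfl, -⟩ | ⟨u, -, hu⟩ | ⟨u, -, hu⟩
  · exact ⟨h1.symm, fun hp => (h2 hp).symm⟩
  · cases hu
  · cases hu

end TwoPointGraph

/-! ### Counting classes by trees -/

open TwoPointGraph

/-- The tree `t` with all labels equal to `l`. -/
def MelonTree.withLabel {L : Type} (l : L) : MelonTree Unit → MelonTree L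
  | .leaf => .leaf
  | .nodeI a b c d => .nodeI (withLabel l a) (withLabel l b) (withLabel l c) (withLabel l d)
  | .nodeII _ a b => .nodeII l (withLabel l a) (withLabel l b)

theorem MelonTree.shape_withLabel {L : Type} (t : MelonTree Unit) (l : L) :
    (t.withLabel l).shape = t := by
  induction t with
  | leaf => rfl
  | nodeI a b c d ha hb hc hd => simp only [withLabel, shape, ha, hb, hc, hd]
  | nodeII l a b ha hb => simp only [withLabel, shape, ha, hb]

/-- Classes of melonic graphs up to local colour permutations are counted by unlabelled trees. -/
theorem melonicClassCount_eq (p q : ℕ) :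
    melonicClassCount p q = {t : MelonTree Unit | t.countI = p ∧ t.countII = q}.ncard := by
  symm
  -- Label 0 is an arbitrary choice of pillow colour: the class depends only on the shape.
  refine Set.ncard_congr (fun t _ => Quotient.mk localSetoid (ofTree (t.withLabel 0))) ?_ ?_ ?_
  · rintro t ⟨rfl, rfl⟩
    obtain ⟨G, hG, e, he⟩ := isMelonicUpToIso_ofTree (t.withLabel 0)
    rw [← MelonTree.countI_shape, ← MelonTree.countII_shape, t.shape_withLabel] at hG
    exact ⟨G, hG, Quotient.sound ⟨e, _, he, fun _ _ => rfl⟩⟩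
  · rintro t t' - - h
    obtain ⟨e, π, he⟩ := Quotient.exact h
    rw [← t.shape_withLabel (0 : Fin 3), ← t'.shape_withLabel (0 : Fin 3)]
    exact (shape_eq_of_locallyIsomorphic he).1
  · rintro _ ⟨G, hG, rfl⟩
    obtain ⟨t, h1, h2, e, he⟩ := hG.exists_tree
    obtain ⟨f, π, hf⟩ := isLocalIso_ofTree (t.shape.withLabel 0) t (t.shape.shape_withLabel 0)
    refine ⟨t.shape, ⟨t.countI_shape.trans h1, t.countII_shape.trans h2⟩, Quotient.sound ?_⟩
    have hf' : LocallyIsomorphic (ofTree (t.shape.withLabel 0)) (ofTree t) := ⟨f, π, hf⟩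
    have hG' : LocallyIsomorphic (ofTree t) G := ⟨e.symm, _, he.symm, fun _ _ => rfl⟩
    exact localSetoid.iseqv.trans hf' hG'

/-- Melonic graphs are counted by labelled trees. -/
theorem melonicGraphCount_eq (n : ℕ) :
    melonicGraphCount n = {t : MelonTree (Fin 3) | t.countI + t.countII = n}.ncard := by
  symm
  refine Set.ncard_congr (fun t _ => Quotient.mk isoSetoid (ofTree t)) ?_ ?_ ?_
  · rintro t ht
    obtain ⟨G, hG, e, he⟩ := isMelonicUpToIso_ofTree t
    have hiso : Isomorphic G (ofTree t) := ⟨e, he⟩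
    exact ⟨_, _, G, ht, hG, Quotient.sound hiso⟩
  · rintro t t' - - h
    obtain ⟨e, he⟩ := Quotient.exact h
    exact (shape_eq_of_locallyIsomorphic ⟨he, fun _ _ => rfl⟩).2 fun _ => rfl
  · rintro _ ⟨p, q, G, hpq, hG, rfl⟩
    obtain ⟨t, h1, h2, e, he⟩ := hG.exists_tree
    have hiso : Isomorphic G (ofTree t) := ⟨e, he⟩
    exact ⟨t, by simp [h1, h2, hpq], (Quotient.sound hiso).symm⟩

/-! ### Generating series of trees -/

section fiberSeries

variable {X Y : Type*}

/-- The generating series of the elements of `X` counted by size with a weight. -/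
noncomputable def fiberSeries (s : X → ℕ) (h : ∀ n, {x | s x = n}.Finite) (w : X → ℝ) :
    PowerSeries ℝ :=
  PowerSeries.mk fun n => ∑ x ∈ (h n).toFinset, w x

theorem finite_fiber_prod {s : X → ℕ} (h : ∀ n, {x | s x = n}.Finite) {s' : Y → ℕ}
    (h' : ∀ n, {y | s' y = n}.Finite) (n : ℕ) : {p : X × Y | s p.1 + s' p.2 = n}.Finite := by
  refine (((Finset.range (n + 1)).finite_toSet.biUnion fun i _ => h i).prod
    ((Finset.range (n + 1)).finite_toSet.biUnion fun i _ => h' i)).subset ?_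
  rintro ⟨x, y⟩ (hxy : s x + s' y = n)
  simp only [Set.mem_prod, Set.mem_iUnion, Finset.coe_range, Set.mem_Iio, Set.mem_ofPred_eq]
  exact ⟨⟨s x, by omega, rfl⟩, ⟨s' y, by omega, rfl⟩⟩

theorem fiberSeries_prod {s : X → ℕ} (h : ∀ n, {x | s x = n}.Finite) {s' : Y → ℕ}
    (h' : ∀ n, {y | s' y = n}.Finite) (w : X → ℝ) (w' : Y → ℝ) :
    fiberSeries (fun p : X × Y => s p.1 + s' p.2) (finite_fiber_prod h h')
      (fun p => w p.1 * w' p.2) = fiberSeries s h w * fiberSeries s' h' w' := by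
  classical
  ext n
  rw [PowerSeries.coeff_mul]
  simp only [fiberSeries, PowerSeries.coeff_mk]
  rw [← Finset.sum_fiberwise_of_maps_to (g := fun p : X × Y => (s p.1, s' p.2))
    (t := Finset.HasAntidiagonal.antidiagonal n) (fun p hp => by simpa using hp)]
  refine Finset.sum_congr rfl fun ij hij => ?_
  rw [Finset.sum_mul_sum, ← Finset.sum_product']
  refine Finset.sum_congr ?_ fun _ _ => rfl
  ext p
  simp only [Finset.mem_filter, Set.Finite.mem_toFinset, Set.mem_ofPred_eq, Finset.mem_product,
    Prod.ext_iff]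
  rw [Finset.HasAntidiagonal.mem_antidiagonal] at hij
  constructor
  · exact fun h => h.2
  · rintro ⟨h1, h2⟩
    exact ⟨by rw [h1, h2, hij], h1, h2⟩

end fiberSeries

namespace MelonTree

variable {L : Type}

/-- The number of nodes. -/
def size (t : MelonTree L) : ℕ := t.countI + t.countII

/-- A tree of size less than `n + 1` is a leaf or a node over trees of size less than `n`, with
finitely many possible labels. -/
theorem finite_size_lt [Finite L] (n : ℕ) : {t : MelonTree L | t.size < n}.Finite := by
  induction n with
  | zero => simp
  | succ n ih =>
    refine (((Set.finite_singleton (leaf : MelonTree L)).union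
      (((ih.prod ih).prod (ih.prod ih)).image fun p => nodeI p.1.1 p.1.2 p.2.1 p.2.2)).union
      (((Set.finite_univ (α := L)).prod (ih.prod ih)).image
        fun p => nodeII p.1 p.2.1 p.2.2)).subset ?_
    intro t ht
    cases t with
    | leaf => exact Or.inl (Or.inl rfl)
    | nodeI a b c d =>
      simp only [size, countI, countII, Set.mem_ofPred_eq] at ht
      refine Or.inl (Or.inr ⟨((a, b), (c, d)), ⟨⟨?_, ?_⟩, ?_, ?_⟩, rfl⟩) <;>
        simp only [size, Set.mem_ofPred_eq] <;> omega
    | nodeII l a b =>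
      simp only [size, countI, countII, Set.mem_ofPred_eq] at ht
      refine Or.inr ⟨(l, (a, b)), ⟨trivial, ?_, ?_⟩, rfl⟩ <;>
        simp only [size, Set.mem_ofPred_eq] <;> omega

theorem finite_size_eq [Finite L] (n : ℕ) : {t : MelonTree L | t.size = n}.Finite :=
  (finite_size_lt (n + 1)).subset fun t (ht : t.size = n) => by
    simp [ht]

/-- The generating series of trees, with weight `μ` for the nodes of type II. -/
noncomputable def series (L : Type) [Finite L] (μ : ℝ) : PowerSeries ℝ :=
  fiberSeries (size : MelonTree L → ℕ) finite_size_eq fun t => μ ^ t.countII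

/-- Root decomposition: a tree is a leaf, or a quadruple of trees, or a label with a pair of trees.
The extra node accounts for the factor `X`, and the choice of label for `Fintype.card L`. -/
theorem series_eq (L : Type) [Fintype L] (μ : ℝ) :
    series L μ = 1 + PowerSeries.X *
      (series L μ ^ 4 + PowerSeries.C (Fintype.card L * μ) * series L μ ^ 2) := by
  classical
  have h2 : series L μ ^ 2 = fiberSeries _ (finite_fiber_prod finite_size_eq finite_size_eq) _ :=
    (pow_two _).trans (fiberSeries_prod finite_size_eq finite_size_eq (fun t => μ ^ t.countII)
      (fun t : MelonTree L => μ ^ t.countII)).symm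
  have h4 : series L μ ^ 4 = fiberSeries _ (finite_fiber_prod
      (finite_fiber_prod finite_size_eq finite_size_eq)
      (finite_fiber_prod finite_size_eq finite_size_eq)) _ :=
    (show series L μ ^ 4 = series L μ ^ 2 * series L μ ^ 2 by ring).trans
      (by rw [h2]; exact (fiberSeries_prod _ _ _ _).symm)
  ext n
  rcases n with _ | n
  · simp only [map_add, PowerSeries.coeff_zero_X_mul, add_zero, PowerSeries.coeff_zero_one]
    simp only [series, fiberSeries, PowerSeries.coeff_mk]
    have h0 : (finite_size_eq (L := L) 0).toFinset = {leaf} := by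
      ext t
      cases t <;> simp [size, countI, countII]
    rw [h0, Finset.sum_singleton]
    simp [countII]
  · rw [map_add, PowerSeries.coeff_succ_X_mul, PowerSeries.coeff_one, if_neg n.succ_ne_zero,
      zero_add, map_add, PowerSeries.coeff_C_mul, h2, h4]
    simp only [series, fiberSeries, PowerSeries.coeff_mk]
    set F4 := (finite_fiber_prod
      (finite_fiber_prod (finite_size_eq (L := L)) (finite_size_eq (L := L)))
      (finite_fiber_prod (finite_size_eq (L := L)) (finite_size_eq (L := L))) n).toFinset with hF4
    set F2 := (finite_fiber_prod (finite_size_eq (L := L)) (finite_size_eq (L := L)) n).toFinset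
      with hF2
    have hset : (finite_size_eq (L := L) (n + 1)).toFinset =
        (F4.image fun p => nodeI p.1.1 p.1.2 p.2.1 p.2.2) ∪
        ((Finset.univ ×ˢ F2).image fun p => nodeII p.1 p.2.1 p.2.2) := by
      ext t
      simp only [Set.Finite.mem_toFinset, Set.mem_ofPred_eq, Finset.mem_union, Finset.mem_image,
        hF4, hF2, Finset.mem_product, Finset.mem_univ, true_and, Prod.exists]
      cases t with
      | leaf => simp [size, countI, countII]
      | nodeI a b c d =>
        simp only [nodeI.injEq, reduceCtorEq, and_false, exists_false, or_false]
        constructor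
        · intro h
          refine ⟨a, b, c, d, ?_, rfl, rfl, rfl, rfl⟩
          simp only [size, countI, countII] at h ⊢
          omega
        · rintro ⟨a, b, c, d, h, rfl, rfl, rfl, rfl⟩
          simp only [size, countI, countII] at h ⊢
          omega
      | nodeII l a b =>
        simp only [nodeII.injEq, reduceCtorEq, and_false, exists_false, false_or]
        constructor
        · intro h
          refine ⟨l, a, b, ?_, rfl, rfl, rfl⟩
          simp only [size, countI, countII] at h ⊢
          omega
        · rintro ⟨l, a, b, h, rfl, rfl, rfl⟩
          simp only [size, countI, countII] at h ⊢
          omega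
    rw [hset, Finset.sum_union, Finset.sum_image, Finset.sum_image, Finset.sum_product]
    · congr 1
      · refine Finset.sum_congr rfl fun p _ => ?_
        simp only [countII]
        ring
      · simp only [countII, Finset.sum_const, Finset.card_univ, nsmul_eq_mul, mul_assoc]
        congr 1
        rw [Finset.mul_sum]
        refine Finset.sum_congr rfl fun p _ => ?_
        ring
    · rintro ⟨l, a, b⟩ - ⟨l', a', b'⟩ - h
      simpa using h
    · rintro ⟨⟨a, b⟩, c, d⟩ - ⟨⟨a', b'⟩, c', d'⟩ - h
      simp only [nodeI.injEq] at h
      simp only [Prod.mk.injEq]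
      tauto
    · rw [Finset.disjoint_left]
      rintro _ h1 h2
      obtain ⟨_, _, rfl⟩ := Finset.mem_image.1 h1
      obtain ⟨_, _, h⟩ := Finset.mem_image.1 h2
      cases h

end MelonTree

/-- The difference of the equations is a multiple of `A - B` by a series with constant term 1, hence
nonzero. -/
theorem PowerSeries.eq_of_quartic_equation {A B : PowerSeries ℝ} {c : ℝ}
    (hA : A = 1 + PowerSeries.X * (A ^ 4 + PowerSeries.C c * A ^ 2))
    (hB : B = 1 + PowerSeries.X * (B ^ 4 + PowerSeries.C c * B ^ 2)) : A = B := by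
  have h : (1 - PowerSeries.X * (A ^ 3 + A ^ 2 * B + A * B ^ 2 + B ^ 3 +
      PowerSeries.C c * (A + B))) * (A - B) = 0 := by
    linear_combination hA - hB
  rcases mul_eq_zero.1 h with h | h
  · have := congrArg PowerSeries.constantCoeff h
    simp at this
  · exact sub_eq_zero.1 h

theorem leadingOrderSeries_eq_series (μ : ℝ) :
    leadingOrderSeries μ = MelonTree.series Unit μ := by
  classical
  ext n
  simp only [leadingOrderSeries, MelonTree.series, fiberSeries, PowerSeries.coeff_mk]
  rw [← Finset.sum_fiberwise_of_maps_to (g := fun t : MelonTree Unit => t.countII)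
    (t := Finset.range (n + 1))]
  · refine Finset.sum_congr rfl fun q hq => ?_
    rw [Finset.mem_range] at hq
    rw [Finset.sum_congr rfl (g := fun _ => μ ^ q) fun t ht => by rw [(Finset.mem_filter.1 ht).2],
      Finset.sum_const, nsmul_eq_mul, melonicClassCount_eq]
    congr 2
    rw [← Set.ncard_coe_finset]
    congr 1
    ext t
    simp only [Set.mem_ofPred_eq, Finset.coe_filter, Set.Finite.mem_toFinset, MelonTree.size]
    omega
  · intro t ht
    simp only [Set.Finite.mem_toFinset, Set.mem_ofPred_eq, MelonTree.size] at ht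
    simp only [Finset.mem_range]
    omega

theorem leadingOrderSeries_equation (μ : ℝ) :
    leadingOrderSeries μ = 1 + PowerSeries.X *
      (leadingOrderSeries μ ^ 4 + PowerSeries.C μ * leadingOrderSeries μ ^ 2) := by
  rw [leadingOrderSeries_eq_series]
  simpa using MelonTree.series_eq Unit μ

/-- Three colours per pillow with weight 1 and no colour with weight 3 give the same functional
equation, hence the same series. -/
theorem melonicGraphCount_eq_coeff (n : ℕ) :
    (melonicGraphCount n : ℝ) = PowerSeries.coeff n (leadingOrderSeries 3) := by
  have h : leadingOrderSeries 3 = MelonTree.series (Fin 3) 1 := by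
    refine PowerSeries.eq_of_quartic_equation (leadingOrderSeries_equation 3) ?_
    have := MelonTree.series_eq (Fin 3) 1
    simpa only [Fintype.card_fin, mul_one, Nat.cast_ofNat] using this
  rw [h, melonicGraphCount_eq]
  simp only [MelonTree.series, fiberSeries, PowerSeries.coeff_mk, one_pow, Finset.sum_const,
    nsmul_eq_mul, mul_one]
  rw [← Set.ncard_coe_finset, Set.Finite.coe_toFinset]
  rfl

/-! ### Lagrange inversion -/

section Lagrange

theorem PowerSeries.coeff_pow_eq_zero_of_X_dvd {B : PowerSeries ℝ} (hB : PowerSeries.X ∣ B)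
    {n j : ℕ} (h : n < j) : PowerSeries.coeff n (B ^ j) = 0 :=
  PowerSeries.X_pow_dvd_iff.1 (pow_dvd_pow_of_dvd hB j) n h

theorem PowerSeries.coeff_aeval_of_X_dvd {B : PowerSeries ℝ} (hB : PowerSeries.X ∣ B)
    (P : Polynomial ℝ) (n : ℕ) : PowerSeries.coeff n (Polynomial.aeval B P) =
      ∑ j ∈ Finset.range (n + 1), P.coeff j * PowerSeries.coeff n (B ^ j) := by
  rw [Polynomial.aeval_eq_sum_range' (n := P.natDegree + n + 1) (by omega), map_sum]
  simp only [PowerSeries.coeff_smul, smul_eq_mul]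
  symm
  refine Finset.sum_subset (Finset.range_mono (by omega)) fun j _ hj => ?_
  rw [PowerSeries.coeff_pow_eq_zero_of_X_dvd hB (by simpa using hj), mul_zero]

/-- The Lagrange inversion formula for powers of the solution of `B = X φ(B)`. -/
theorem PowerSeries.lagrange_inversion (φ : Polynomial ℝ) {B : PowerSeries ℝ}
    (hB : B = PowerSeries.X * Polynomial.aeval B φ) (n k : ℕ) :
    ((n + k : ℕ) : ℝ) * PowerSeries.coeff (n + k) (B ^ k) = k * (φ ^ (n + k)).coeff n := by
  have hX : PowerSeries.X ∣ B := Dvd.intro _ hB.symm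
  induction n using Nat.strong_induction_on generalizing k with
  | _ n ih =>
    have hk : PowerSeries.coeff (n + k) (B ^ k) =
        PowerSeries.coeff n (Polynomial.aeval B (φ ^ k)) := by
      conv_lhs => rw [hB, mul_pow, ← map_pow, PowerSeries.coeff_X_pow_mul]
    rw [hk]
    rcases Nat.eq_zero_or_pos n with rfl | hn
    · rw [PowerSeries.coeff_aeval_of_X_dvd hX]
      simp
    have hn' : (n : ℝ) ≠ 0 := by positivity
    -- Expand φ(B)^k in powers of `B`. The induction hypothesis at `n - j` gives n [X^n] B^j = j
    -- [x^(n-j)] φ^n for j ≥ 1, and the factor j turns φ^k into its derivative.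
    have hder : (n : ℝ) * PowerSeries.coeff n (Polynomial.aeval B (φ ^ k)) =
        (Polynomial.X * Polynomial.derivative (φ ^ k) * φ ^ n).coeff n := by
      rw [PowerSeries.coeff_aeval_of_X_dvd hX, Polynomial.coeff_mul,
        Finset.Nat.sum_antidiagonal_eq_sum_range_succ_mk, Finset.mul_sum]
      refine Finset.sum_congr rfl fun j hj => ?_
      rcases j with _ | j
      · simp [PowerSeries.coeff_one, hn.ne']
      · have hj' : j + 1 ≤ n := by simpa [Nat.lt_succ_iff] using hj
        have := ih (n - (j + 1)) (by omega) (j + 1)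
        rw [Nat.sub_add_cancel hj'] at this
        rw [Polynomial.coeff_X_mul, Polynomial.coeff_derivative]
        push_cast at this
        linear_combination (φ ^ k).coeff (j + 1) * this
    -- Both sides are multiples of φ^(n+k-1) φ': this is (n + k)(φ^k)' φ^n = k (φ^(n+k))'.
    have hpow : (n + k : ℕ) • (Polynomial.X * Polynomial.derivative (φ ^ k) * φ ^ n) =
        k • (Polynomial.X * Polynomial.derivative (φ ^ (n + k))) := by
      rcases k with _ | k
      · simp
      · rw [Polynomial.derivative_pow, Polynomial.derivative_pow]
        simp only [nsmul_eq_mul, Nat.add_sub_cancel, map_natCast,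
          show n + (k + 1) - 1 = n + k by omega]
        push_cast
        ring
    have hcoeff := congrArg (fun P => Polynomial.coeff P n) hpow
    simp only [Polynomial.coeff_smul] at hcoeff
    simp only [nsmul_eq_mul] at hcoeff
    obtain ⟨m, rfl⟩ : ∃ m, n = m + 1 := ⟨n - 1, by omega⟩
    rw [← hder, Polynomial.coeff_X_mul, Polynomial.coeff_derivative] at hcoeff
    apply mul_left_cancel₀ hn'
    push_cast at hcoeff ⊢
    linear_combination hcoeff

end Lagrange

/-- The polynomial `φ` such that `B = G - 1` satisfies `B = g φ(B)`. -/
noncomputable def lagrangePoly (μ : ℝ) : Polynomial ℝ :=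
  (1 + Polynomial.X) ^ 2 * ((1 + Polynomial.X) ^ 2 + Polynomial.C μ)

theorem coeff_leadingOrderSeries (μ : ℝ) (n : ℕ) :
    ((n + 1 : ℕ) : ℝ) * PowerSeries.coeff (n + 1) (leadingOrderSeries μ) =
      (lagrangePoly μ ^ (n + 1)).coeff n := by
  have hB : leadingOrderSeries μ - 1 =
      PowerSeries.X * Polynomial.aeval (leadingOrderSeries μ - 1) (lagrangePoly μ) := by
    have h := leadingOrderSeries_equation μ
    have hC : algebraMap ℝ (PowerSeries ℝ) μ = PowerSeries.C μ := rfl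
    simp only [lagrangePoly, map_mul, map_pow, map_add, map_one, Polynomial.aeval_X,
      Polynomial.aeval_C, hC]
    linear_combination h
  have := PowerSeries.lagrange_inversion (lagrangePoly μ) hB n 1
  rw [pow_one, Nat.cast_one, one_mul, map_sub, PowerSeries.coeff_one, if_neg n.succ_ne_zero,
    sub_zero] at this
  exact this

/-! ### A local limit theorem -/

-- Second-order Taylor expansion of the exponential; the cubic remainder contributes at most ‖z‖³
-- exp ‖z‖ / √n.
open Topology Real in
theorem tendsto_natCast_mul_exp_sub (z : ℂ) :
    Tendsto (fun n : ℕ => (n : ℂ) * (Complex.exp (z / √(n : ℝ)) - 1 - z / √(n : ℝ))) atTop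
      (𝓝 (z ^ 2 / 2)) := by
  have hsqrt : Tendsto (fun n : ℕ => √(n : ℝ)) atTop atTop :=
    Real.tendsto_sqrt_atTop.comp tendsto_natCast_atTop_atTop
  have h0 : Tendsto (fun n : ℕ => ‖z‖ ^ 3 * Real.exp ‖z‖ / √(n : ℝ)) atTop (𝓝 0) :=
    tendsto_const_nhds.div_atTop hsqrt
  rw [tendsto_iff_norm_sub_tendsto_zero]
  refine squeeze_zero' (Eventually.of_forall fun _ => norm_nonneg _) ?_ h0
  filter_upwards [eventually_ge_atTop 1] with n hn
  have hn1 : (1 : ℝ) ≤ n := by exact_mod_cast hn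
  have hs1 : 1 ≤ √(n : ℝ) := Real.one_le_sqrt.2 hn1
  have hs0 : 0 < √(n : ℝ) := by linarith
  have hsq : ((√(n : ℝ) : ℝ) : ℂ) ^ 2 = n := by
    rw [← Complex.ofReal_pow, Real.sq_sqrt (by linarith)]; simp
  have hsC : ((√(n : ℝ) : ℝ) : ℂ) ≠ 0 := by exact_mod_cast hs0.ne'
  have hb := Complex.norm_exp_sub_sum_le_norm_mul_exp (z / √(n : ℝ)) 3
  have hnorm : ‖z / (√(n : ℝ) : ℂ)‖ = ‖z‖ / √(n : ℝ) := by
    rw [norm_div, Complex.norm_real, Real.norm_of_nonneg hs0.le]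
  have heq : (n : ℂ) * (Complex.exp (z / √(n : ℝ)) - 1 - z / √(n : ℝ)) - z ^ 2 / 2 =
      n * (Complex.exp (z / √(n : ℝ)) -
        ∑ m ∈ Finset.range 3, (z / √(n : ℝ)) ^ m / (m.factorial : ℂ)) := by
    simp only [Finset.sum_range_succ, Finset.sum_range_zero, Nat.factorial]
    have : (n : ℂ) * (z / (√(n : ℝ) : ℂ)) ^ 2 = z ^ 2 := by
      rw [← hsq]; field_simp
    push_cast
    linear_combination (1 / 2) * this
  rw [heq, norm_mul, Complex.norm_natCast]
  rw [hnorm] at hb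
  calc (n : ℝ) * _ ≤ n * ((‖z‖ / √(n : ℝ)) ^ 3 * Real.exp (‖z‖ / √(n : ℝ))) := by gcongr
    _ ≤ n * ((‖z‖ / √(n : ℝ)) ^ 3 * Real.exp ‖z‖) := by
        gcongr
        exact div_le_self (norm_nonneg _) hs1
    _ = ‖z‖ ^ 3 * Real.exp ‖z‖ / √(n : ℝ) := by
        have : (n : ℝ) = √(n : ℝ) ^ 2 := (Real.sq_sqrt (by linarith)).symm
        rw [this, Real.sqrt_sq hs0.le]
        field_simp

section LocalLimit

variable {ι : Type*} [Fintype ι]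

/-- The trigonometric sum with weights `w` and frequencies `κ`. -/
noncomputable def trigSum (w κ : ι → ℝ) (θ : ℝ) : ℂ :=
  ∑ j, (w j : ℂ) * Complex.exp (κ j * θ * Complex.I)

theorem continuous_trigSum (w κ : ι → ℝ) : Continuous (trigSum w κ) := by
  unfold trigSum
  fun_prop

-- The central limit theorem for characteristic functions. Since the mean vanishes, n times the
-- deviation of the sum from 1 tends to minus half the variance times s², and (1 + x_n)^n tends to
-- exp of the limit of n x_n.
open Topology Real in
theorem tendsto_trigSum_pow {w κ : ι → ℝ} (hw : ∑ j, w j = 1) (hκ : ∑ j, w j * κ j = 0) (s : ℝ) :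
    Tendsto (fun n : ℕ => trigSum w κ (s / √(n : ℝ)) ^ n) atTop
      (𝓝 (Complex.exp (-(∑ j, w j * κ j ^ 2) / 2 * s ^ 2 : ℝ))) := by
  have h1 : Tendsto (fun n : ℕ => ∑ j, (w j : ℂ) * ((n : ℂ) *
      (Complex.exp ((κ j * s * Complex.I) / √(n : ℝ)) - 1 -
        (κ j * s * Complex.I) / √(n : ℝ)))) atTop
      (𝓝 (∑ j, (w j : ℂ) * ((κ j * s * Complex.I) ^ 2 / 2))) :=
    tendsto_finsetSum _ fun j _ => (tendsto_natCast_mul_exp_sub _).const_mul _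
  have hlim : ∑ j, (w j : ℂ) * ((κ j * s * Complex.I) ^ 2 / 2) =
      ((-(∑ j, w j * κ j ^ 2) / 2 * s ^ 2 : ℝ) : ℂ) := by
    push_cast
    rw [← Finset.sum_neg_distrib, Finset.sum_div, Finset.sum_mul]
    refine Finset.sum_congr rfl fun j _ => ?_
    rw [mul_pow, Complex.I_sq]
    ring
  rw [hlim] at h1
  have h2 := Complex.tendsto_one_add_pow_exp_of_tendsto
    (g := fun n : ℕ => trigSum w κ (s / √(n : ℝ)) - 1) (h1.congr fun n => ?_)
  · simpa using h2
  · have hwC : ∑ j, (w j : ℂ) = 1 := by exact_mod_cast congrArg Complex.ofReal hw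
    have hκC : ∑ j, (w j : ℂ) * κ j = 0 := by exact_mod_cast congrArg Complex.ofReal hκ
    have hsplit : ∀ j, (w j : ℂ) * ((n : ℂ) *
        (Complex.exp ((κ j * s * Complex.I) / √(n : ℝ)) - 1 -
          (κ j * s * Complex.I) / √(n : ℝ))) =
        n * (w j * Complex.exp (κ j * ((s / √(n : ℝ) : ℝ) : ℂ) * Complex.I)) - n * w j -
          (n * (s * Complex.I / √(n : ℝ))) * (w j * κ j) := by
      intro j
      have : (κ j * s * Complex.I) / (√(n : ℝ) : ℂ) =
          κ j * ((s / √(n : ℝ) : ℝ) : ℂ) * Complex.I := by push_cast; ring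
      rw [this]
      push_cast
      ring
    simp only [hsplit, Finset.sum_sub_distrib, ← Finset.mul_sum, hwC, hκC, trigSum]
    ring

open Topology Real MeasureTheory in
/-- A local limit theorem: asymptotics of a Fourier coefficient of the powers of a centred
trigonometric sum. -/
theorem tendsto_sqrt_mul_integral_trigSum_pow {w κ : ι → ℝ} (hw : ∑ j, w j = 1)
    (hκ : ∑ j, w j * κ j = 0) {c : ℝ} (hc : 0 < c)
    (hbound : ∀ θ : ℝ, |θ| ≤ π → ‖trigSum w κ θ‖ ≤ Real.exp (-c * θ ^ 2)) :
    Tendsto (fun n : ℕ => ((√(n : ℝ) : ℝ) : ℂ) *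
        ∫ θ in -π..π, trigSum w κ θ ^ n * Complex.exp (θ * Complex.I)) atTop
      (𝓝 ((√(2 * π / ∑ j, w j * κ j ^ 2) : ℝ) : ℂ)) := by
  set v := ∑ j, w j * κ j ^ 2 with hv
  let f : ℕ → ℝ → ℂ := fun n s =>
    trigSum w κ (s / √(n : ℝ)) ^ n * Complex.exp ((s / √(n : ℝ) : ℝ) * Complex.I)
  -- The substitution θ = s / √n absorbs the factor √n and spreads the integral over an interval
  -- that exhausts the line.
  let F : ℕ → ℝ → ℂ := fun n => (Set.Ioc (-π * √(n : ℝ)) (π * √(n : ℝ))).indicator (f n)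
  have hfc : ∀ n, Continuous (f n) := by
    intro n
    have := continuous_trigSum w κ
    simp only [f]
    fun_prop
  have hF : ∀ᶠ n : ℕ in atTop, ∫ s, F n s = ((√(n : ℝ) : ℝ) : ℂ) *
      ∫ θ in -π..π, trigSum w κ θ ^ n * Complex.exp (θ * Complex.I) := by
    filter_upwards [eventually_ge_atTop 1] with n hn
    have hs0 : 0 < √(n : ℝ) := Real.sqrt_pos.2 (by exact_mod_cast hn)
    have hle : -π * √(n : ℝ) ≤ π * √(n : ℝ) := by nlinarith [Real.pi_pos]
    simp only [F]
    rw [integral_indicator measurableSet_Ioc, ← intervalIntegral.integral_of_le hle]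
    have := intervalIntegral.integral_comp_div (a := -π * √(n : ℝ)) (b := π * √(n : ℝ))
      (fun θ : ℝ => trigSum w κ θ ^ n * Complex.exp (θ * Complex.I)) hs0.ne'
    rw [mul_div_cancel_right₀ _ hs0.ne', mul_div_cancel_right₀ _ hs0.ne', Complex.real_smul] at this
    exact this
  have hlim : Tendsto (fun n => ∫ s, F n s) atTop
      (𝓝 (∫ s : ℝ, Complex.exp (-v / 2 * s ^ 2 : ℝ))) := by
    refine tendsto_integral_of_dominated_convergence (fun s => Real.exp (-c * s ^ 2))
      (fun n => ((hfc n).aestronglyMeasurable.indicator measurableSet_Ioc))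
      (integrable_exp_neg_mul_sq hc) (fun n => Eventually.of_forall fun s => ?_)
      (Eventually.of_forall fun s => ?_)
    · simp only [F]
      by_cases hs : s ∈ Set.Ioc (-π * √(n : ℝ)) (π * √(n : ℝ))
      · rw [Set.indicator_of_mem hs]
        -- For n = 0 the interval is empty.
        have hn : (0 : ℝ) < √(n : ℝ) := by
          by_contra h
          have h0 : √(n : ℝ) = 0 := le_antisymm (not_lt.1 h) (Real.sqrt_nonneg _)
          rw [h0] at hs
          have := hs.1.trans_le hs.2
          simp at this
        have habs : |s / √(n : ℝ)| ≤ π := by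
          rw [abs_div, abs_of_pos hn, div_le_iff₀ hn, abs_le]
          exact ⟨by linarith [hs.1], hs.2⟩
        simp only [f]
        rw [norm_mul, Complex.norm_exp_ofReal_mul_I, mul_one, norm_pow]
        -- The n-th power of the Gaussian bound at s / √n is exp(-c s²), independent of n.
        refine (pow_le_pow_left₀ (norm_nonneg _) (hbound _ habs) n).trans (le_of_eq ?_)
        rw [← Real.exp_nat_mul, div_pow, Real.sq_sqrt (Nat.cast_nonneg n)]
        congr 1
        have : (n : ℝ) ≠ 0 := fun h => by simp [h] at hn
        field_simp
      · rw [Set.indicator_of_notMem hs, norm_zero]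
        positivity
    · have hsqrt : Tendsto (fun n : ℕ => √(n : ℝ)) atTop atTop :=
        Real.tendsto_sqrt_atTop.comp tendsto_natCast_atTop_atTop
      have h1 : Tendsto (fun n : ℕ => Complex.exp ((s / √(n : ℝ) : ℝ) * Complex.I)) atTop
          (𝓝 1) := by
        have h : Tendsto (fun n : ℕ => s / √(n : ℝ)) atTop (𝓝 0) :=
          tendsto_const_nhds.div_atTop hsqrt
        have hcont : Continuous fun x : ℝ => Complex.exp (x * Complex.I) := by fun_prop
        have h' := (hcont.tendsto 0).comp h
        rw [Complex.ofReal_zero, zero_mul, Complex.exp_zero] at h'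
        exact h'
      have h2 := (tendsto_trigSum_pow hw hκ s).mul h1
      rw [mul_one] at h2
      refine h2.congr' ?_
      have hev : ∀ᶠ n : ℕ in atTop, |s| / π + 1 ≤ √(n : ℝ) := hsqrt.eventually_ge_atTop _
      filter_upwards [hev] with n hn
      have : |s| < π * √(n : ℝ) := by
        have : |s| / π < √(n : ℝ) := by linarith
        rwa [div_lt_iff₀' Real.pi_pos] at this
      have hmem : s ∈ Set.Ioc (-π * √(n : ℝ)) (π * √(n : ℝ)) :=
        ⟨by linarith [(abs_lt.1 this).1], (abs_lt.1 this).2.le⟩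
      simp only [F]
      rw [Set.indicator_of_mem hmem]
  have hgauss : ∫ s : ℝ, Complex.exp (-v / 2 * s ^ 2 : ℝ) = ((√(2 * π / v) : ℝ) : ℂ) := by
    simp only [← Complex.ofReal_exp]
    rw [integral_complex_ofReal, neg_div, integral_gaussian]
    congr 2
    field_simp
  rw [hgauss] at hlim
  exact hlim.congr' hF

end LocalLimit

/-! ### Cauchy's formula for polynomial coefficients -/

open Real in
theorem integral_exp_int_mul (k : ℤ) :
    ∫ θ in -π..π, Complex.exp (k * θ * Complex.I) = if k = 0 then 2 * (π : ℂ) else 0 := by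
  split_ifs with hk
  · subst hk
    simp
    ring
  · have hc : (k : ℂ) * Complex.I ≠ 0 := by simp [hk]
    have h : ∀ θ : ℝ, Complex.exp (k * θ * Complex.I) = Complex.exp (k * Complex.I * θ) :=
      fun θ => by ring_nf
    simp only [h]
    rw [integral_exp_mul_complex hc]
    have h1 : Complex.exp (k * Complex.I * (π : ℂ)) =
        Complex.exp (k * Complex.I * ((-π : ℝ) : ℂ)) := by
      rw [Complex.exp_eq_exp_iff_exists_int]
      exact ⟨k, by push_cast; ring⟩
    rw [h1, sub_self, zero_div]

open Real in
/-- Cauchy's formula for the coefficients of a polynomial. -/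
theorem integral_aeval_mul_exp (P : Polynomial ℝ) (τ : ℝ) (m : ℕ) :
    ∫ θ in -π..π, Polynomial.aeval (τ * Complex.exp (θ * Complex.I)) P *
      Complex.exp (-(m * θ) * Complex.I) = ((2 * π * τ ^ m * P.coeff m : ℝ) : ℂ) := by
  have hterm : ∀ θ : ℝ, Polynomial.aeval (τ * Complex.exp (θ * Complex.I)) P *
      Complex.exp (-(m * θ) * Complex.I) = ∑ i ∈ Finset.range (P.natDegree + m + 1),
        ((P.coeff i * τ ^ i : ℝ) : ℂ) * Complex.exp (((i - m : ℤ) : ℂ) * θ * Complex.I) := by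
    intro θ
    rw [Polynomial.aeval_eq_sum_range' (n := P.natDegree + m + 1) (by omega), Finset.sum_mul]
    refine Finset.sum_congr rfl fun i _ => ?_
    rw [mul_pow, ← Complex.exp_nat_mul, Complex.real_smul, mul_assoc, mul_assoc, ← Complex.exp_add]
    push_cast
    rw [mul_assoc]
    congr 4
    ring
  simp only [hterm]
  rw [intervalIntegral.integral_finsetSum]
  · simp only [intervalIntegral.integral_const_mul, integral_exp_int_mul, sub_eq_zero]
    rw [Finset.sum_eq_single m]
    · push_cast
      simp
      ring
    · intro i _ hi
      rw [if_neg (by exact_mod_cast hi), mul_zero]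
    · intro h
      exact absurd (Finset.mem_range.2 (by omega)) h
  · intro i _
    exact Continuous.intervalIntegrable (by fun_prop) _ _

/-! ### The saddle point and the asymptotics of the coefficients -/

section critical

variable {μ : ℝ}

theorem criticalG_equation (hμ : 0 ≤ μ) :
    -3 * criticalG μ ^ 3 + 4 * criticalG μ ^ 2 - μ * criticalG μ + 2 * μ = 0 := by
  rw [criticalG, dif_pos hμ]
  exact (existsUnique_critical_root μ hμ).choose_spec.1.2

theorem four_div_three_le_criticalG (hμ : 0 ≤ μ) : 4 / 3 ≤ criticalG μ := by
  have h0 : criticalG μ ≠ 0 := by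
    rw [criticalG, dif_pos hμ]
    exact (existsUnique_critical_root μ hμ).choose_spec.1.1
  have h := criticalG_equation hμ
  by_contra! hlt
  have h1 : 0 < criticalG μ ^ 2 * (4 - 3 * criticalG μ) := mul_pos (by positivity) (by linarith)
  have h2 : 0 ≤ μ * (2 - criticalG μ) := mul_nonneg hμ (by linarith)
  nlinarith

/-- The value of `lagrangePoly μ` at `criticalG μ - 1`. -/
noncomputable def criticalPhi (μ : ℝ) : ℝ := criticalG μ ^ 2 * (criticalG μ ^ 2 + μ)

theorem criticalPhi_pos (hμ : 0 ≤ μ) : 0 < criticalPhi μ := by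
  have := four_div_three_le_criticalG hμ
  unfold criticalPhi
  positivity

/-- The probability weights of the terms of `lagrangePoly μ` at `criticalG μ - 1`. -/
noncomputable def saddleWeight (μ : ℝ) : Fin 5 → ℝ :=
  ![(1 + μ) / criticalPhi μ, (4 + 2 * μ) * (criticalG μ - 1) / criticalPhi μ,
    (6 + μ) * (criticalG μ - 1) ^ 2 / criticalPhi μ, 4 * (criticalG μ - 1) ^ 3 / criticalPhi μ,
    (criticalG μ - 1) ^ 4 / criticalPhi μ]

/-- The centred exponents of the terms of `lagrangePoly μ`. -/
def saddleExponent : Fin 5 → ℝ := ![-1, 0, 1, 2, 3]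

theorem sum_saddleWeight (hμ : 0 ≤ μ) : ∑ j, saddleWeight μ j = 1 := by
  have h := (criticalPhi_pos hμ).ne'
  simp only [saddleWeight, Fin.sum_univ_five, Matrix.cons_val]
  field_simp
  unfold criticalPhi
  ring

/-- The saddle-point equation τ φ'(τ) = φ(τ) at τ = G_c - 1; it is the cubic equation of G_c
multiplied by -G_c. -/
theorem sum_saddleWeight_mul (hμ : 0 ≤ μ) : ∑ j, saddleWeight μ j * saddleExponent j = 0 := by
  have h := (criticalPhi_pos hμ).ne'
  simp only [saddleWeight, saddleExponent, Fin.sum_univ_five, Matrix.cons_val]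
  field_simp
  linear_combination (-criticalG μ) * criticalG_equation hμ

/-- As the exponents have mean 1, their variance is the second factorial moment τ² φ''(τ) / φ(τ). -/
theorem sum_saddleWeight_mul_sq (hμ : 0 ≤ μ) : ∑ j, saddleWeight μ j * saddleExponent j ^ 2 =
    (criticalG μ - 1) ^ 2 * (12 * criticalG μ ^ 2 + 2 * μ) / criticalPhi μ := by
  have h := (criticalPhi_pos hμ).ne'
  simp only [saddleWeight, saddleExponent, Fin.sum_univ_five, Matrix.cons_val]
  field_simp
  linear_combination criticalG μ * criticalG_equation hμ

theorem trigSum_saddle (hμ : 0 ≤ μ) (θ : ℝ) :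
    trigSum (saddleWeight μ) saddleExponent θ =
      Polynomial.aeval (((criticalG μ - 1 : ℝ) : ℂ) * Complex.exp (θ * Complex.I))
        (lagrangePoly μ) * Complex.exp (-θ * Complex.I) / (criticalPhi μ : ℂ) := by
  have h : (criticalPhi μ : ℂ) ≠ 0 := by exact_mod_cast (criticalPhi_pos hμ).ne'
  simp only [trigSum, saddleWeight, saddleExponent, Fin.sum_univ_five, Matrix.cons_val,
    lagrangePoly, map_mul, map_pow, map_add, map_one, Polynomial.aeval_X, Polynomial.aeval_C,
    Complex.coe_algebraMap]
  set E := Complex.exp (θ * Complex.I) with hE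
  have h1 : Complex.exp (((-1 : ℝ) : ℂ) * θ * Complex.I) = E⁻¹ := by
    rw [hE, ← Complex.exp_neg]; push_cast; ring_nf
  have h1' : Complex.exp (-θ * Complex.I) = E⁻¹ := by
    rw [hE, ← Complex.exp_neg]; ring_nf
  have h2 : Complex.exp (((0 : ℝ) : ℂ) * θ * Complex.I) = 1 := by simp
  have h3 : Complex.exp (((1 : ℝ) : ℂ) * θ * Complex.I) = E := by simp [hE]
  have h4 : Complex.exp (((2 : ℝ) : ℂ) * θ * Complex.I) = E ^ 2 := by
    rw [hE, ← Complex.exp_nat_mul]; push_cast; ring_nf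
  have h5 : Complex.exp (((3 : ℝ) : ℂ) * θ * Complex.I) = E ^ 3 := by
    rw [hE, ← Complex.exp_nat_mul]; push_cast; ring_nf
  have hE0 : E ≠ 0 := Complex.exp_ne_zero _
  rw [h1, h1', h2, h3, h4, h5]
  push_cast
  field_simp
  ring

-- Put u = 1 + τ exp(iθ). Then |φ| ≤ |u|² (G² + μ), so the quotient by φ(τ) is at most |u|² / G².
-- Here |u|² = G² - 2τ (1 - cos θ), and 1 - cos θ ≥ 2θ²/π² on [-π, π]; finally 1 + x ≤ exp x.
open Real in
theorem norm_trigSum_saddle_le (hμ : 0 ≤ μ) (θ : ℝ) (hθ : |θ| ≤ π) :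
    ‖trigSum (saddleWeight μ) saddleExponent θ‖ ≤
      Real.exp (-(4 * (criticalG μ - 1) / (π ^ 2 * criticalG μ ^ 2)) * θ ^ 2) := by
  have hG := four_div_three_le_criticalG hμ
  set G := criticalG μ with hGdef
  have hΦ : criticalPhi μ = G ^ 2 * (G ^ 2 + μ) := rfl
  set u : ℂ := 1 + ((G - 1 : ℝ) : ℂ) * Complex.exp (θ * Complex.I) with hu
  have hEn : ‖Complex.exp (-θ * Complex.I)‖ = 1 := by
    rw [← Complex.ofReal_neg]; exact Complex.norm_exp_ofReal_mul_I _
  have hnu : ‖u‖ ^ 2 = G ^ 2 - 2 * (G - 1) * (1 - Real.cos θ) := by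
    rw [← Complex.normSq_eq_norm_sq, Complex.normSq_apply, hu, Complex.exp_mul_I]
    simp only [Complex.add_re, Complex.add_im, Complex.mul_re, Complex.mul_im, Complex.one_re,
      Complex.one_im, Complex.ofReal_re, Complex.ofReal_im, Complex.I_re, Complex.I_im,
      ← Complex.ofReal_cos, ← Complex.ofReal_sin]
    have := Real.sin_sq_add_cos_sq θ
    linear_combination (G - 1) ^ 2 * this
  have hnu' : ‖u‖ ^ 2 ≤ G ^ 2 := by
    rw [hnu]
    nlinarith [Real.cos_le_one θ]
  have hval : trigSum (saddleWeight μ) saddleExponent θ =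
      u ^ 2 * (u ^ 2 + (μ : ℂ)) * Complex.exp (-θ * Complex.I) / (criticalPhi μ : ℂ) := by
    rw [trigSum_saddle hμ]
    simp only [lagrangePoly, map_mul, map_pow, map_add, map_one, Polynomial.aeval_X,
      Polynomial.aeval_C, Complex.coe_algebraMap, hu]
    rfl
  rw [hval, norm_div, norm_mul, norm_mul, hEn, mul_one, norm_pow, Complex.norm_real,
    Real.norm_of_nonneg (criticalPhi_pos hμ).le]
  have h2 : ‖u ^ 2 + (μ : ℂ)‖ ≤ G ^ 2 + μ := by
    refine (norm_add_le _ _).trans ?_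
    rw [norm_pow, Complex.norm_real, Real.norm_of_nonneg hμ]
    linarith
  have hG0 : 0 < G := by linarith
  have hcos := Real.cos_le_one_sub_mul_cos_sq hθ
  calc ‖u‖ ^ 2 * ‖u ^ 2 + (μ : ℂ)‖ / criticalPhi μ
      ≤ ‖u‖ ^ 2 * (G ^ 2 + μ) / criticalPhi μ := by
        have := (criticalPhi_pos hμ).le
        gcongr
    _ = ‖u‖ ^ 2 / G ^ 2 := by
        rw [hΦ]
        have : G ^ 2 + μ ≠ 0 := by positivity
        field_simp
    _ ≤ (G ^ 2 - 2 * (G - 1) * (2 / π ^ 2 * θ ^ 2)) / G ^ 2 := by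
        rw [hnu]
        have : 0 ≤ 2 * (G - 1) := by linarith
        gcongr
        linarith
    _ = -(4 * (G - 1) / (π ^ 2 * G ^ 2)) * θ ^ 2 + 1 := by
        field_simp
        ring
    _ ≤ _ := Real.add_one_le_exp _

open Topology Real in
theorem tendsto_coeff_mul (hμ : 0 ≤ μ) :
    Tendsto (fun n : ℕ => √(n : ℝ) * (n * PowerSeries.coeff n (leadingOrderSeries μ)) *
      (2 * π / (criticalG μ - 1)) * criticalCoupling μ ^ n) atTop
      (𝓝 (√π * criticalK μ / (criticalG μ - 1))) := by
  have hG := four_div_three_le_criticalG hμ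
  have hτ : 0 < criticalG μ - 1 := by linarith
  have hΦ := criticalPhi_pos hμ
  have key := tendsto_sqrt_mul_integral_trigSum_pow (sum_saddleWeight hμ)
    (sum_saddleWeight_mul hμ) (c := 4 * (criticalG μ - 1) / (π ^ 2 * criticalG μ ^ 2))
    (by have := Real.pi_pos; positivity) (norm_trigSum_saddle_le hμ)
  have hlim : √(2 * π / ∑ j, saddleWeight μ j * saddleExponent j ^ 2) =
      √π * criticalK μ / (criticalG μ - 1) := by
    rw [sum_saddleWeight_mul_sq hμ, criticalK, ← Real.sqrt_mul Real.pi_pos.le]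
    rw [eq_div_iff hτ.ne', ← Real.sqrt_sq hτ.le, ← Real.sqrt_mul (by positivity),
      Real.sqrt_sq hτ.le]
    congr 1
    change 2 * π / ((criticalG μ - 1) ^ 2 * (12 * criticalG μ ^ 2 + 2 * μ) / criticalPhi μ) *
      (criticalG μ - 1) ^ 2 = π * (criticalPhi μ / (6 * criticalG μ ^ 2 + μ))
    have : 12 * criticalG μ ^ 2 + 2 * μ ≠ 0 := by positivity
    have : 6 * criticalG μ ^ 2 + μ ≠ 0 := by positivity
    field_simp
    ring
  rw [hlim] at key
  have key' := (Complex.continuous_re.tendsto _).comp key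
  rw [Complex.ofReal_re] at key'
  refine key'.congr' ?_
  filter_upwards [eventually_ge_atTop 1] with n hn
  obtain ⟨m, rfl⟩ : ∃ m, n = m + 1 := ⟨n - 1, by omega⟩
  -- The phase of the centred sum to the power m + 1 is exp(-i(m + 1)θ). The extra factor exp(iθ)
  -- leaves exp(-imθ), which extracts the coefficient of index m given by Lagrange inversion.
  have hint : ∫ θ in -π..π, trigSum (saddleWeight μ) saddleExponent θ ^ (m + 1) *
      Complex.exp (θ * Complex.I) = ((2 * π * (criticalG μ - 1) ^ m *
        (lagrangePoly μ ^ (m + 1)).coeff m / criticalPhi μ ^ (m + 1) : ℝ) : ℂ) := by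
    rw [Complex.ofReal_div, ← integral_aeval_mul_exp, ← intervalIntegral.integral_div]
    refine intervalIntegral.integral_congr fun θ _ => ?_
    simp only [trigSum_saddle hμ, map_pow, div_pow, mul_pow, ← Complex.exp_nat_mul,
      Complex.ofReal_pow]
    rw [div_mul_eq_mul_div, mul_assoc, ← Complex.exp_add]
    congr 3
    push_cast
    ring
  simp only [Function.comp]
  rw [hint, ← Complex.ofReal_mul, Complex.ofReal_re, ← coeff_leadingOrderSeries]
  have hg : criticalCoupling μ = (criticalG μ - 1) / criticalPhi μ := rfl
  rw [hg, div_pow]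
  field_simp
  ring

open Topology Real in
theorem coeff_leadingOrderSeries_isEquivalent (hμ : 0 ≤ μ) :
    (fun n : ℕ => PowerSeries.coeff n (leadingOrderSeries μ)) ~[atTop]
      fun n : ℕ => criticalK μ * criticalCoupling μ ^ (-(n : ℤ)) /
        (2 * √π * (n : ℝ) ^ (3 / 2 : ℝ)) := by
  have hG := four_div_three_le_criticalG hμ
  have hτ : 0 < criticalG μ - 1 := by linarith
  have hK : 0 < criticalK μ := Real.sqrt_pos.2 (by positivity)
  have hg : 0 < criticalCoupling μ := by unfold criticalCoupling; positivity
  have hpi : 0 < √π := Real.sqrt_pos.2 Real.pi_pos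
  refine isEquivalent_of_tendsto_one ?_
  have h := (tendsto_coeff_mul hμ).mul_const ((criticalG μ - 1) / (√π * criticalK μ))
  rw [div_mul_div_cancel₀ hτ.ne', div_self (by positivity)] at h
  refine h.congr' ?_
  filter_upwards [eventually_ge_atTop 1] with n hn
  have hn0 : (0 : ℝ) < n := by exact_mod_cast hn
  have hpow : (n : ℝ) ^ (3 / 2 : ℝ) = n * √(n : ℝ) := by
    rw [Real.sqrt_eq_rpow, ← Real.rpow_one_add' hn0.le (by norm_num)]
    norm_num
  have hsq : √π * √π = π := Real.mul_self_sqrt Real.pi_pos.le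
  simp only [Pi.div_apply]
  rw [hpow, zpow_neg, zpow_natCast]
  have := pow_pos hg n
  field_simp
  rw [Real.sq_sqrt Real.pi_pos.le]

end critical

/-! ### Numerical values at μ = 3 -/

/-- For a ≥ 4/3 the difference of the values of the cubic at `x` and at `a` is a - x times a
positive factor, so the sign of the cubic at `a` locates the root. -/
theorem criticalG_three_bounds : 1.5324 < criticalG 3 ∧ criticalG 3 < 1.5325 := by
  have h := criticalG_equation (μ := 3) (by norm_num)
  have h0 := four_div_three_le_criticalG (μ := 3) (by norm_num)
  set x := criticalG 3
  have hpos : ∀ a : ℝ, 4 / 3 ≤ a → 0 < 3 * (x ^ 2 + x * a + a ^ 2) - 4 * (x + a) + 3 :=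
    fun a ha => by nlinarith
  constructor
  · by_contra! hx
    have := mul_nonneg (sub_nonneg.2 hx) (hpos 1.5324 (by norm_num)).le
    linarith [show (1.5324 - x) * (3 * (x ^ 2 + x * 1.5324 + 1.5324 ^ 2) - 4 * (x + 1.5324) + 3) =
      -(-3 * (1.5324 : ℝ) ^ 3 + 4 * 1.5324 ^ 2 - 3 * 1.5324 + 2 * 3) by linear_combination h]
  · by_contra! hx
    have := mul_nonneg (sub_nonneg.2 hx) (hpos 1.5325 (by norm_num)).le
    linarith [show (x - 1.5325) * (3 * (x ^ 2 + x * 1.5325 + 1.5325 ^ 2) - 4 * (x + 1.5325) + 3) =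
      -3 * (1.5325 : ℝ) ^ 3 + 4 * 1.5325 ^ 2 - 3 * 1.5325 + 2 * 3 by linear_combination -h]

theorem abs_inv_criticalCoupling_three_sub_lt : |1 / criticalCoupling 3 - 23.6| < 0.05 := by
  obtain ⟨h1, h2⟩ := criticalG_three_bounds
  rw [criticalCoupling, one_div_div]
  set x := criticalG 3
  have hx : 0 < x - 1 := by linarith
  have hl : (1.5324 : ℝ) ^ 2 ≤ x ^ 2 := by gcongr
  have hu : x ^ 2 ≤ (1.5325 : ℝ) ^ 2 := by gcongr
  have hl' : (1.5324 : ℝ) ^ 2 * (1.5324 ^ 2 + 3) ≤ x ^ 2 * (x ^ 2 + 3) := by gcongr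
  have hu' : x ^ 2 * (x ^ 2 + 3) ≤ (1.5325 : ℝ) ^ 2 * (1.5325 ^ 2 + 3) := by gcongr
  rw [abs_lt, lt_sub_iff_add_lt, sub_lt_iff_lt_add, lt_div_iff₀ hx, div_lt_iff₀ hx]
  constructor <;> nlinarith

theorem abs_criticalK_three_sub_lt : |criticalK 3 / (2 * √Real.pi) - 0.242| < 0.0005 := by
  obtain ⟨h1, h2⟩ := criticalG_three_bounds
  rw [criticalK]
  set x := criticalG 3
  have hl : (1.5324 : ℝ) ^ 2 ≤ x ^ 2 := by gcongr
  have hu : x ^ 2 ≤ (1.5325 : ℝ) ^ 2 := by gcongr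
  have hl' : (1.5324 : ℝ) ^ 2 * (1.5324 ^ 2 + 3) ≤ x ^ 2 * (x ^ 2 + 3) := by gcongr
  have hu' : x ^ 2 * (x ^ 2 + 3) ≤ (1.5325 : ℝ) ^ 2 * (1.5325 ^ 2 + 3) := by gcongr
  have hd : 0 < 6 * x ^ 2 + 3 := by positivity
  have hp1 := Real.pi_gt_d4
  have hp2 := Real.pi_lt_d4
  -- With everything under one square root, both bounds can be checked after squaring.
  have hK : √(x ^ 2 * (x ^ 2 + 3) / (6 * x ^ 2 + 3)) / (2 * √Real.pi) =
      √(x ^ 2 * (x ^ 2 + 3) / (6 * x ^ 2 + 3) / (4 * Real.pi)) := by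
    have h4 : √(4 * Real.pi) = 2 * √Real.pi := by
      rw [Real.sqrt_mul (by norm_num), show (4 : ℝ) = 2 ^ 2 by norm_num,
        Real.sqrt_sq (by norm_num)]
    rw [Real.sqrt_div' _ (by positivity : 0 ≤ 4 * Real.pi), h4]
  rw [hK, abs_lt, lt_sub_iff_add_lt, sub_lt_iff_lt_add]
  constructor
  · apply Real.lt_sqrt_of_sq_lt
    rw [lt_div_iff₀ (by positivity), lt_div_iff₀ hd]
    nlinarith
  · rw [Real.sqrt_lt' (by norm_num), div_lt_iff₀ (by positivity), div_lt_iff₀ hd]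
    nlinarith

theorem mainTheorem5 :
    (∀ μ : ℝ, 0 ≤ μ →
      (fun n : ℕ => PowerSeries.coeff n (leadingOrderSeries μ)) ~[atTop]
        fun n : ℕ => criticalK μ * criticalCoupling μ ^ (-(n : ℤ)) /
          (2 * √Real.pi * (n : ℝ) ^ (3 / 2 : ℝ))) ∧
    ∃ χ β : ℝ,
      χ = criticalK 3 / (2 * √Real.pi) ∧ β = 1 / criticalCoupling 3 ∧
      |χ - 0.242| < 0.0005 ∧ |β - 23.6| < 0.05 ∧
      (fun n : ℕ => (melonicGraphCount n : ℝ)) ~[atTop]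
        fun n : ℕ => χ * β ^ n / (n : ℝ) ^ (3 / 2 : ℝ) := by
  refine ⟨fun μ hμ => coeff_leadingOrderSeries_isEquivalent hμ, _, _, rfl, rfl,
    abs_criticalK_three_sub_lt, abs_inv_criticalCoupling_three_sub_lt, ?_⟩
  have h := coeff_leadingOrderSeries_isEquivalent (μ := 3) (by norm_num)
  simp only [← melonicGraphCount_eq_coeff] at h
  refine h.congr_right (Eventually.of_forall fun n => ?_)
  simp only [zpow_neg, zpow_natCast, one_div, inv_pow]
  rw [mul_div_right_comm, div_mul_eq_div_div, mul_div_right_comm]
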